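/- Let $A\in\mathbb{R}^{N\times N}$ be symmetric with simple eigenvalues $\lambda_1<\dots<\lambda_N$ and corresponding orthonormal eigenvectors $q_1,\dots,q_N$. Let $1\le k\le N$, assume $\lambda_{N-k+1}>0$, and let $0\ne u\in\operatorname{span}\{q_{N-k+1},\dots,q_N\}$. Fix $0<\lambda'_{\min}<\lambda_{N-k+1}$ and $\lambda_{\max}>\lambda_N$, and let $A^\dagger$ denote the Moore–Penrose pseudo-inverse of $A$. Run the Gauss Quadrature Lanczos algorithm on $(A,u)$. Put $u_{-1}=0$, $u_0=u/\|u\|$, $\beta_0=0$ and, for $i\ge 1$, $$\alpha_i=u_{i-1}^\top Au_{i-1},\quad \tilde u_i=Au_{i-1}-\alpha_iu_{i-1}-\beta_{i-1}u_{i-2},\quad \beta_i=\|\tilde u_i\|,\quad u_i=\tilde u_i/\beta_i ;$$ the iteration stops with the first index $K\ge 1$ for which $\beta_K=0$. For $\tau\in\mathbb{R}$ let $\delta_1^{\tau}=\alpha_1-\tau$ and $\delta_i^\tau=\alpha_i-\tau-\beta_{i-1}^2/\delta_{i-1}^\tau$ for $i\ge 2$, and write $\delta_i=\delta_i^{0}$,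 $\delta_i^{-}=\delta_i^{\lambda'_{\min}}$, $\delta_i^{+}=\delta_i^{\lambda_{\max}}$. Let $c_1=1$, $c_i=c_{i-1}\beta_{i-1}/\delta_{i-1}$, and $$\Delta_i(a,b)=\frac{\|u\|^2\,b\,c_i^2}{\delta_i(a\delta_i-b)} .$$ The Gauss iterates are $g_1=\|u\|^2/\alpha_1$, $g_i=g_{i-1}+\Delta_{i-1}(\alpha_i,\beta_{i-1}^2)$. The left Gauss–Radau, right Gauss–Radau and Gauss–Lobatto iterates are $$g_i^{\rm lr}=g_i+\Delta_i\Bigl(\lambda'_{\min}+\tfrac{\beta_i^2}{\delta_i^-},\beta_i^2\Bigr),\quad g_i^{\rm rr}=g_i+\Delta_i\Bigl(\lambda_{\max}+\tfrac{\beta_i^2}{\delta_i^+},\beta_i^2\Bigr),\quad g_i^{\rm lo}=g_i+\Delta_i(a_i,b_i),$$ $$a_i=\frac{\delta_i^-\delta_i^+}{\delta_i^+-\delta_i^-}\Bigl(\frac{\lambda_{\max}}{\delta_i^-}-\frac{\lambda'_{\min}}{\delta_i^+}\Bigr),\qquad b_i=\frac{\delta_i^-\delta_i^+}{\delta_i^+-\delta_i^-}(\lambda_{\max}-\lambda'_{\min}).$$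 Then the iteration stops with some $K\le k$ (and $K=k$ if $q_j^\top u\ne 0$ for all $j>N-k$), the final iterates are exact, $$g_K=g_K^{\rm rr}=g_K^{\rm lr}=u^\top A^\dagger u,$$ and, with $\kappa'=\lambda_N/\lambda_{N-k+1}$, $\kappa_m'=\lambda_N/\lambda'_{\min}$ and $\rho=\frac{\sqrt{\kappa'}-1}{\sqrt{\kappa'}+1}$, for all $1\le i\le K$ (where $0^0=1$): $$0\le\frac{g_K-g_i}{g_K}\le 2\rho^i,\qquad 0\le\frac{g_K-g_i^{\rm rr}}{g_K}\le 2\rho^i,\qquad 0\le\frac{g_i^{\rm lr}-g_K}{g_K}\le 2\kappa_m'\rho^i,\qquad 0\le\frac{g_i^{\rm lo}-g_K}{g_K}\le 2\kappa_m'\rho^{i-1},$$ and for $i\ge 3$ moreover $$\frac{g_i^{\rm lo}-g_K}{g_K}\le 2\kappa_m'\rho^{i}.$$ -/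

import Mathlib

noncomputable section

namespace GQL

/-- `P` is the Moore–Penrose pseudo-inverse `A†` of the real square matrix `A`
(the four Penrose equations determine `P` uniquely). -/
structure IsPseudoInverse {N : ℕ} (A P : Matrix (Fin N) (Fin N) ℝ) : Prop where
  mul_mul_self : A * P * A = A
  self_mul_mul : P * A * P = P
  symm_left : (A * P).transpose = A * P
  symm_right : (P * A).transpose = P * A

/-- A real symmetric matrix has a pseudo-inverse. -/
theorem exists_isPseudoInverse {N : ℕ} (A : Matrix (Fin N) (Fin N) ℝ) (hA : A.IsSymm) :
    ∃ P, IsPseudoInverse A P := by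
  have hH : A.IsHermitian := by
    rw [Matrix.IsHermitian, Matrix.conjTranspose_eq_transpose_of_trivial]; exact hA
  set U : Matrix (Fin N) (Fin N) ℝ := (hH.eigenvectorUnitary : Matrix (Fin N) (Fin N) ℝ) with hU
  set d : Fin N → ℝ := hH.eigenvalues with hd
  have hUU : U.transpose * U = 1 := by
    have := Unitary.coe_star_mul_self hH.eigenvectorUnitary
    rwa [Matrix.star_eq_conjTranspose, Matrix.conjTranspose_eq_transpose_of_trivial] at this
  have hAe : A = U * Matrix.diagonal d * U.transpose := by
    have := hH.spectral_theorem
    rw [Unitary.conjStarAlgAut_apply, Matrix.star_eq_conjTranspose,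
      Matrix.conjTranspose_eq_transpose_of_trivial] at this
    exact this
  have key : ∀ a b : Fin N → ℝ, (U * Matrix.diagonal a * U.transpose) *
      (U * Matrix.diagonal b * U.transpose)
        = U * Matrix.diagonal (fun i => a i * b i) * U.transpose := by
    intro a b
    calc _ = U * Matrix.diagonal a * (U.transpose * U) * Matrix.diagonal b * U.transpose := by
          simp only [Matrix.mul_assoc]
      _ = _ := by
          rw [hUU, Matrix.mul_one, Matrix.mul_assoc U, Matrix.diagonal_mul_diagonal]
  have keyT : ∀ a : Fin N → ℝ, (U * Matrix.diagonal a * U.transpose).transpose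
      = U * Matrix.diagonal a * U.transpose := by
    intro a
    simp [Matrix.transpose_mul, Matrix.mul_assoc]
  refine ⟨U * Matrix.diagonal (fun i => (d i)⁻¹) * U.transpose, ?_, ?_, ?_, ?_⟩
  · rw [hAe, key, key, show (fun i => d i * (d i)⁻¹ * d i) = d from
      funext fun i => mul_inv_mul_cancel (d i)]
  · rw [hAe, key, key, show (fun i => (d i)⁻¹ * d i * (d i)⁻¹) = fun i => (d i)⁻¹ from
      funext fun i => by simpa using mul_inv_mul_cancel (d i)⁻¹]
  · rw [hAe, key, keyT]
  · rw [hAe, key, keyT]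

variable {N : ℕ}

/-- The data of the Lanczos iteration after step `i`: the vectors `u_{i-1}` (`prev`) and `u_i`
(`cur`), and the coefficients `α_i` and `β_i`. -/
structure LanczosState (N : ℕ) where
  prev : EuclideanSpace ℝ (Fin N)
  cur : EuclideanSpace ℝ (Fin N)
  alpha : ℝ
  beta : ℝ

/-- The unnormalized vector `ũ_i = A u_{i-1} - α_i u_{i-1} - β_{i-1} u_{i-2}`, where
`α_i = u_{i-1}ᵀ A u_{i-1}`, computed from the state after step `i - 1`. -/
def LanczosState.residual (A : Matrix (Fin N) (Fin N) ℝ) (s : LanczosState N) :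
    EuclideanSpace ℝ (Fin N) :=
  A.toEuclideanLin s.cur - (inner ℝ s.cur (A.toEuclideanLin s.cur)) • s.cur - s.beta • s.prev

/-- The Lanczos iteration for `A` started at `u`, with `u_{-1} = 0` and `u_0 = u / ‖u‖`.
Step `i` computes `α_i = u_{i-1}ᵀ A u_{i-1}`, `β_i = ‖ũ_i‖` and `u_i = ũ_i / β_i`.
(The values `α_0 = β_0 = 0` are placeholders.) -/
def lanczos (A : Matrix (Fin N) (Fin N) ℝ) (u : EuclideanSpace ℝ (Fin N)) : ℕ → LanczosState N
  | 0 => ⟨0, ‖u‖⁻¹ • u, 0, 0⟩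
  | i + 1 =>
    let s := lanczos A u i
    ⟨s.cur, ‖s.residual A‖⁻¹ • s.residual A,
      inner ℝ s.cur (A.toEuclideanLin s.cur), ‖s.residual A‖⟩

/-- The diagonal entry `α_i` (`i ≥ 1`) of the Jacobi matrix. -/
def lanczosAlpha (A : Matrix (Fin N) (Fin N) ℝ) (u : EuclideanSpace ℝ (Fin N)) (i : ℕ) : ℝ :=
  (lanczos A u i).alpha

/-- The off-diagonal entry `β_i` (`i ≥ 1`) of the Jacobi matrix. -/
def lanczosBeta (A : Matrix (Fin N) (Fin N) ℝ) (u : EuclideanSpace ℝ (Fin N)) (i : ℕ) : ℝ :=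
  (lanczos A u i).beta

/-- The Lanczos iteration stops with step `K`: `K ≥ 1` is the first index with `β_K = 0`,
so that `u_K = ũ_K / β_K` cannot be formed. -/
def StopsAt (A : Matrix (Fin N) (Fin N) ℝ) (u : EuclideanSpace ℝ (Fin N)) (K : ℕ) : Prop :=
  1 ≤ K ∧ lanczosBeta A u K = 0 ∧ ∀ j, 1 ≤ j → j < K → lanczosBeta A u j ≠ 0

/-- The pivots `δ_1 = α_1 - τ`, `δ_i = α_i - τ - β_{i-1}² / δ_{i-1}` of `J_i - τ I`. The shift
`τ = 0` gives `δ_i`, `τ = λ_min` gives `δ_i^{lr}` and `τ = λ_max` gives `δ_i^{rr}`. -/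
def delta (A : Matrix (Fin N) (Fin N) ℝ) (u : EuclideanSpace ℝ (Fin N)) (τ : ℝ) : ℕ → ℝ
  | 0 => 0
  | 1 => lanczosAlpha A u 1 - τ
  | i + 2 => lanczosAlpha A u (i + 2) - τ - lanczosBeta A u (i + 1) ^ 2 / delta A u τ (i + 1)

/-- `c_1 = 1`, `c_i = c_{i-1} β_{i-1} / δ_{i-1}`. -/
def coeff (A : Matrix (Fin N) (Fin N) ℝ) (u : EuclideanSpace ℝ (Fin N)) : ℕ → ℝ
  | 0 => 0
  | 1 => 1
  | i + 2 => coeff A u (i + 1) * lanczosBeta A u (i + 1) / delta A u 0 (i + 1)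

/-- The Sherman–Morrison increment `‖u‖² b c_i² / (δ_i (a δ_i - b))` that is added to the
Gauss value `‖u‖² [J_i⁻¹]_{11}` when `J_i` is extended by one row and column with diagonal
entry `a` and squared off-diagonal entry `b`. -/
def increment (A : Matrix (Fin N) (Fin N) ℝ) (u : EuclideanSpace ℝ (Fin N)) (i : ℕ)
    (a b : ℝ) : ℝ :=
  ‖u‖ ^ 2 * b * coeff A u i ^ 2 / (delta A u 0 i * (a * delta A u 0 i - b))

/-- The Gauss iterates: `g_1 = ‖u‖² / α_1`, and `g_i` arises from `g_{i-1}` by extending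
`J_{i-1}` with `α_i` and `β_{i-1}`. -/
def gauss (A : Matrix (Fin N) (Fin N) ℝ) (u : EuclideanSpace ℝ (Fin N)) : ℕ → ℝ
  | 0 => 0
  | 1 => ‖u‖ ^ 2 / lanczosAlpha A u 1
  | i + 2 => gauss A u (i + 1) +
      increment A u (i + 1) (lanczosAlpha A u (i + 2)) (lanczosBeta A u (i + 1) ^ 2)

/-- The Gauss–Radau iterates with prescribed node `τ`: `J_i` is extended with the off-diagonal
entry `β_i` and the diagonal entry `τ + β_i² / δ_i^{(τ)}`. -/
def radau (A : Matrix (Fin N) (Fin N) ℝ) (u : EuclideanSpace ℝ (Fin N)) (τ : ℝ) (i : ℕ) : ℝ :=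
  gauss A u i +
    increment A u i (τ + lanczosBeta A u i ^ 2 / delta A u τ i) (lanczosBeta A u i ^ 2)

/-- The left Gauss–Radau iterates, with prescribed node `λ_min`. -/
def leftRadau (A : Matrix (Fin N) (Fin N) ℝ) (u : EuclideanSpace ℝ (Fin N)) (lmin : ℝ)
    (i : ℕ) : ℝ :=
  radau A u lmin i

/-- The right Gauss–Radau iterates, with prescribed node `λ_max`. -/
def rightRadau (A : Matrix (Fin N) (Fin N) ℝ) (u : EuclideanSpace ℝ (Fin N)) (lmax : ℝ)
    (i : ℕ) : ℝ :=
  radau A u lmax i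

/-- The diagonal entry `α_i^{lo}` of the Gauss–Lobatto extension of `J_i`. -/
def lobattoAlpha (A : Matrix (Fin N) (Fin N) ℝ) (u : EuclideanSpace ℝ (Fin N)) (lmin lmax : ℝ)
    (i : ℕ) : ℝ :=
  delta A u lmin i * delta A u lmax i / (delta A u lmax i - delta A u lmin i) *
    (lmax / delta A u lmin i - lmin / delta A u lmax i)

/-- The squared off-diagonal entry `(β_i^{lo})²` of the Gauss–Lobatto extension of `J_i`. -/
def lobattoBetaSq (A : Matrix (Fin N) (Fin N) ℝ) (u : EuclideanSpace ℝ (Fin N)) (lmin lmax : ℝ)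
    (i : ℕ) : ℝ :=
  delta A u lmin i * delta A u lmax i / (delta A u lmax i - delta A u lmin i) * (lmax - lmin)

/-- The Gauss–Lobatto iterates, with prescribed nodes `λ_min` and `λ_max`. -/
def lobatto (A : Matrix (Fin N) (Fin N) ℝ) (u : EuclideanSpace ℝ (Fin N)) (lmin lmax : ℝ)
    (i : ℕ) : ℝ :=
  gauss A u i + increment A u i (lobattoAlpha A u lmin lmax i) (lobattoBetaSq A u lmin lmax i)

/-- The rate `(√κ - 1) / (√κ + 1)`. -/
def rate (κ : ℝ) : ℝ := (Real.sqrt κ - 1) / (Real.sqrt κ + 1)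

end GQL

end

namespace GQL

open Polynomial

/-! Let μ be the spectral measure of `u`: mass `(q_jᵀu)²` at `λ_j`. Its support lies in `[a, b] =
[λ_{N-k+1}, λ_N]`, its monic orthogonal polynomials `p_n` are the Lanczos polynomials, and with `ν =
μ / x` the target `uᵀA†u` is `ν(1)`. Every iterate equals `ν(1) - ν(χ)/χ(0)`, where `χ` is the
characteristic polynomial of the extended Jacobi matrix, or `p_i` itself for Gauss (`increment_eq`,
`gauss_eq`, both resting on `casoratian`).

The prescribed nodes are roots of `χ`, so `χ = Ω ψ` with `Ω` equal to `1`, `X - τ` or `(X -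
λ'_min)(X - λ_max)`, and `ψ` of degree `m` is orthogonal to lower degrees with respect to `Ω μ`. Up
to a sign, the error `ν(χ)/χ(0)` is the minimum of `ν(ω p²)` over `deg p ≤ m`, `p(0) = 1`, where `ω`
is `Ω` rescaled to be positive on `[a, b]` (`quadrature_error`). This gives the sign of each error,
and a shifted Chebyshev polynomial as competitor (`exists_poly_small_on_Icc`) gives its size.

For Gauss and Radau `m = i`. Lobatto changes both new matrix entries and has only `m = i - 1`;
squaring the Chebyshev bound regains the lost factor once `m ≥ 2` (`sq_two_mul_pow_div_le`).

Exactness and termination follow because `p_K` vanishes on the support of μ. -/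

/-! ### Chebyshev polynomials and the rate. -/

theorem rate_nonneg {κ : ℝ} (hκ : 1 ≤ κ) : 0 ≤ rate κ :=
  div_nonneg (sub_nonneg.2 (Real.one_le_sqrt.2 hκ)) (by positivity)

theorem rate_le_one (κ : ℝ) : rate κ ≤ 1 :=
  div_le_one_of_le₀ (by linarith) (by positivity)

/-- This is `T_n(cosh θ) = cosh (n θ)` at `θ = log z`; it evaluates `T_n` outside `[-1, 1]`. -/
theorem eval_T_half_add_inv (z : ℝ) (hz : 0 < z) (n : ℕ) :
    (Chebyshev.T ℝ n).eval ((z + z⁻¹) / 2) = (z ^ n + (z ^ n)⁻¹) / 2 := by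
  have h := Chebyshev.T_real_cosh (Real.log z) n
  rw [Real.cosh_log hz, Int.cast_natCast, ← Real.log_pow, Real.cosh_log (by positivity)] at h
  exact h

/-- Rescaled Chebyshev polynomials are small on `[a, b]`. -/
theorem exists_poly_small_on_Icc {a b : ℝ} (ha : 0 < a) (hab : a ≤ b) (n : ℕ) :
    ∃ p : ℝ[X], p.natDegree ≤ n ∧ p.eval 0 = 1 ∧ ∀ x ∈ Set.Icc a b,
      |p.eval x| ≤ 2 * rate (b / a) ^ n / (1 + (rate (b / a) ^ n) ^ 2) := by
  obtain rfl | hlt := hab.eq_or_lt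
  -- The interval is a point and the rate is `0`, so a polynomial vanishing there is needed, except
  -- for `n = 0`, where `0 ^ 0 = 1` makes the bound `1`.
  · refine ⟨(1 - C a⁻¹ * X) ^ n, ?_, by simp, fun x hx => ?_⟩
    · compute_degree
    · obtain rfl : x = a := le_antisymm hx.2 hx.1
      have h0 : rate (x / x) = 0 := by simp [rate, ha.ne']
      rw [h0, eval_pow]
      have h1 : (1 - C x⁻¹ * X : ℝ[X]).eval x = 0 := by simp [ha.ne']
      rw [h1]
      obtain rfl | hn := eq_or_ne n 0
      · norm_num
      · simp [hn]
  · set z := rate (b / a) with hz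
    have hs : 1 < Real.sqrt (b / a) := Real.lt_sqrt_of_sq_lt (by
      rw [one_pow]; exact (one_lt_div ha).2 hlt)
    have hz0 : 0 < z := div_pos (by linarith) (by linarith)
    have hba : 0 < b - a := sub_pos.2 hlt
    -- The affine map taking `[a, b]` onto `[-1, 1]` with reversed orientation sends `0` to `(b + a)
    -- / (b - a)`; the rate `z` is the solution in `(0, 1)` of this equation.
    have hc : (z + z⁻¹) / 2 = (b + a) / (b - a) := by
      have hsq : Real.sqrt (b / a) ^ 2 = b / a := Real.sq_sqrt (div_pos (ha.trans hlt) ha).le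
      have h1 : Real.sqrt (b / a) - 1 ≠ 0 := by linarith
      have h2 : Real.sqrt (b / a) + 1 ≠ 0 := by linarith
      have h3 : b = Real.sqrt (b / a) ^ 2 * a := by rw [hsq]; field_simp
      have hba' := hba.ne'
      rw [hz, rate]
      set r := Real.sqrt (b / a)
      rw [h3] at hba' ⊢
      rw [show r ^ 2 * a - a = a * ((r - 1) * (r + 1)) by ring]
      field_simp
      ring
    set T := Chebyshev.T ℝ (n : ℤ)
    have hT : T.eval ((b + a) / (b - a)) = (z ^ n + (z ^ n)⁻¹) / 2 := by
      rw [← hc]; exact eval_T_half_add_inv z hz0 n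
    set M := (z ^ n + (z ^ n)⁻¹) / 2 with hM
    have hzn : 0 < z ^ n := by positivity
    have hMpos : 0 < M := by positivity
    refine ⟨C M⁻¹ * T.comp (C ((b + a) / (b - a)) - C (2 / (b - a)) * X), ?_, ?_, fun x hx => ?_⟩
    · refine (natDegree_C_mul_le _ _).trans (natDegree_comp_le.trans ?_)
      have h1 : T.natDegree = n := by simp [T]
      have h2 : (C ((b + a) / (b - a)) - C (2 / (b - a)) * X : ℝ[X]).natDegree ≤ 1 := by
        compute_degree
      rw [h1]
      exact (Nat.mul_le_mul_left n h2).trans_eq (mul_one n)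
    · simp [eval_comp, hT, hMpos.ne']
    · simp only [eval_mul, eval_C, eval_comp, eval_sub, eval_X, abs_mul]
      have h1 : |(b + a) / (b - a) - 2 / (b - a) * x| ≤ 1 := by
        rw [show (b + a) / (b - a) - 2 / (b - a) * x = (b + a - 2 * x) / (b - a) by ring,
          abs_div, abs_of_pos hba, div_le_one hba, abs_le]
        constructor <;> linarith [hx.1, hx.2]
      refine (mul_le_of_le_one_right (abs_nonneg _)
        (Chebyshev.abs_eval_T_real_le_one n h1)).trans_eq ?_
      rw [abs_of_pos (inv_pos.2 hMpos), hM]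
      field_simp
      ring

/-- After clearing denominators this is `2 t ≤ (1 + t²)²`, which follows from `2 t ≤ 1 + t²`. -/
theorem sq_two_mul_div_one_add_sq_le {t : ℝ} (ht : 0 ≤ t) :
    (2 * t / (1 + t ^ 2)) ^ 2 ≤ 2 * t := by
  rw [div_pow, div_le_iff₀ (by positivity)]
  nlinarith [mul_nonneg ht (sq_nonneg (t - 1)), mul_nonneg ht (sq_nonneg t),
    mul_nonneg ht (sq_nonneg (t ^ 2))]

/-- For `m ≥ 2` one step of the Chebyshev bound is gained by squaring it. -/
theorem sq_two_mul_pow_div_le {z : ℝ} (hz : 0 ≤ z) (hz1 : z ≤ 1) {m : ℕ} (hm : 2 ≤ m) :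
    (2 * z ^ m / (1 + (z ^ m) ^ 2)) ^ 2 ≤ 2 * z ^ (m + 1) := by
  obtain ⟨l, rfl⟩ := Nat.exists_eq_add_of_le' (show 1 ≤ m by omega)
  rw [div_pow, div_le_iff₀ (by positivity)]
  set t := z ^ l
  have ht : 0 ≤ t := by positivity
  -- The only use of `m ≥ 2`: with `t = z ^ (m - 1)`, the claim reduces to `2 t ≤ (1 + t² z²)²`, and
  -- `t ≤ z` bounds the right side below by `1 + 2 t⁴`.
  have htz : t ≤ z := by
    simpa using pow_le_pow_of_le_one hz hz1 (show 1 ≤ l by omega)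
  have e1 : z ^ (l + 1) = t * z := pow_succ z l
  have e2 : z ^ (l + 1 + 1) = t * z ^ 2 := by rw [pow_succ, e1]; ring
  rw [e1, e2]
  have h1 : t ^ 2 ≤ z ^ 2 := pow_le_pow_left₀ ht htz 2
  have h2 : t ^ 4 ≤ t ^ 2 * z ^ 2 := by nlinarith [mul_le_mul_of_nonneg_left h1 (sq_nonneg t)]
  have h3 : 2 * t ≤ 1 + 2 * t ^ 4 := by
    nlinarith [sq_nonneg (t ^ 2 - 2 / 5), sq_nonneg (t - 5 / 8)]
  have h4 : 2 * t ≤ (1 + (t * z) ^ 2) ^ 2 := by nlinarith [sq_nonneg ((t * z) ^ 2)]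
  have := mul_le_mul_of_nonneg_left h4 (show 0 ≤ 2 * (t * z ^ 2) by positivity)
  nlinarith

/-! ### Discrete measures and the extremal property of quadrature errors. -/

section Moment

variable {ι : Type*} [Fintype ι]

/-- The linear functional `p ↦ ∑ⱼ wⱼ p(xⱼ)` of the discrete measure with nodes `x`, weights `w`. -/
noncomputable def moment (w x : ι → ℝ) : ℝ[X] →ₗ[ℝ] ℝ where
  toFun p := ∑ j, w j * p.eval (x j)
  map_add' p q := by simp [mul_add, Finset.sum_add_distrib]
  map_smul' c p := by simp [Finset.mul_sum, mul_left_comm]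

theorem moment_apply (w x : ι → ℝ) (p : ℝ[X]) : moment w x p = ∑ j, w j * p.eval (x j) := rfl

theorem moment_C_mul (w x : ι → ℝ) (c : ℝ) (p : ℝ[X]) :
    moment w x (C c * p) = c * moment w x p := by
  rw [← smul_eq_C_mul, map_smul, smul_eq_mul]

/-- The bridge from ν back to μ: a factor `X` cancels the density `1/x`, which turns ν-integrals
into ones where orthogonality applies. -/
theorem moment_div_X_mul {w x : ι → ℝ} (hx : ∀ j, w j ≠ 0 → 0 < x j) (p : ℝ[X]) :
    moment (fun j => w j / x j) x (X * p) = moment w x p := by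
  simp only [moment_apply]
  refine Finset.sum_congr rfl fun j _ => ?_
  by_cases hw : w j = 0
  · simp [hw]
  · have := (hx j hw).ne'
    simp only [eval_mul, eval_X]
    field_simp

theorem moment_nonneg {w x : ι → ℝ} (hw : ∀ j, 0 ≤ w j) {p : ℝ[X]}
    (hp : ∀ j, w j ≠ 0 → 0 ≤ p.eval (x j)) : 0 ≤ moment w x p := by
  refine Finset.sum_nonneg fun j _ => ?_
  by_cases h : w j = 0
  · simp [h]
  · exact mul_nonneg (hw j) (hp j h)

theorem moment_le_of_eval_le {w x : ι → ℝ} (hw : ∀ j, 0 ≤ w j) {p : ℝ[X]} {M : ℝ}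
    (hp : ∀ j, w j ≠ 0 → p.eval (x j) ≤ M) : moment w x p ≤ M * moment w x 1 := by
  have h : 0 ≤ moment w x (C M * 1 - p) := moment_nonneg hw fun j hj => by
    simpa using hp j hj
  rw [map_sub, moment_C_mul] at h
  linarith

/-- Monic polynomials of degree less than `K` do not vanish on the support of the measure. -/
def SeparatesMonic (w x : ι → ℝ) (K : ℕ) : Prop :=
  ∀ m < K, ∀ t : ℝ[X], IsMonicOfDegree t m → ∃ j, w j ≠ 0 ∧ t.eval (x j) ≠ 0

theorem SeparatesMonic.moment_pos {w x : ι → ℝ} (hw : ∀ j, 0 ≤ w j) {K m : ℕ}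
    (hK : SeparatesMonic w x K) (hm : m < K) {t Φ : ℝ[X]} (ht : IsMonicOfDegree t m)
    (hΦ : ∀ j, w j ≠ 0 → 0 < Φ.eval (x j)) : 0 < moment w x (Φ * t ^ 2) := by
  obtain ⟨j, hj, htj⟩ := hK m hm t ht
  refine Finset.sum_pos' (fun i _ => ?_) ⟨j, Finset.mem_univ _, ?_⟩
  · by_cases h : w i = 0
    · simp [h]
    · have := hΦ i h
      have := hw i
      simp only [eval_mul, eval_pow]
      positivity
  · have := hΦ j hj
    have := (hw j).lt_of_ne' hj
    simp only [eval_mul, eval_pow]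
    positivity

theorem exists_eq_X_sub_C_mul_of_eval_eq_zero {p : ℝ[X]} {n : ℕ} (hp : IsMonicOfDegree p (n + 1))
    {τ : ℝ} (h : p.eval τ = 0) : ∃ t, IsMonicOfDegree t n ∧ p = (X - C τ) * t := by
  obtain ⟨t, rfl⟩ := dvd_iff_isRoot.2 h
  exact ⟨t, (isMonicOfDegree_X_sub_one τ).of_mul_left (add_comm n 1 ▸ hp), rfl⟩

theorem degree_lt_of_isMonicOfDegree {p : ℝ[X]} {m n : ℕ} (hp : IsMonicOfDegree p m) (h : m < n) :
    p.degree < n := by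
  rw [degree_eq_natDegree hp.ne_zero, hp.natDegree_eq]
  exact_mod_cast h

/-- If `ψ = (X - τ) t`, then `Ω ψ t = Ω (X - τ) t²` has constant sign on the support and a nonzero
integral, whereas orthogonality to `t` makes that integral zero. -/
theorem SeparatesMonic.eval_ne_zero {w x : ι → ℝ} (hw : ∀ j, 0 ≤ w j) {K m : ℕ}
    (hK : SeparatesMonic w x K) (hm : m ≤ K) {ψ Ω : ℝ[X]} (hψ : IsMonicOfDegree ψ m)
    (horth : ∀ t : ℝ[X], t.degree < m → moment w x (Ω * ψ * t) = 0) {τ σ : ℝ}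
    (hσ : ∀ j, w j ≠ 0 → 0 < σ * (Ω.eval (x j) * (x j - τ))) : ψ.eval τ ≠ 0 := by
  intro h0
  obtain _ | m := m
  · rw [isMonicOfDegree_zero_iff] at hψ
    simp [hψ] at h0
  · obtain ⟨t, ht, rfl⟩ := exists_eq_X_sub_C_mul_of_eval_eq_zero hψ h0
    have h1 := hK.moment_pos hw (Φ := C σ * (Ω * (X - C τ))) hm ht
      (fun j hj => by simpa using hσ j hj)
    have h2 := horth t (degree_lt_of_isMonicOfDegree ht m.lt_succ_self)
    rw [show C σ * (Ω * (X - C τ)) * t ^ 2 = C σ * (Ω * ((X - C τ) * t) * t) by ring,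
      moment_C_mul, h2, mul_zero] at h1
    exact h1.false

theorem degree_divX_lt_of_natDegree_le {p : ℝ[X]} {m : ℕ} (hp : p.natDegree ≤ m) :
    p.divX.degree < m := by
  by_cases h0 : p = 0
  · simp [h0, bot_lt_iff_ne_bot]
  · exact (degree_divX_lt h0).trans_le (degree_le_of_natDegree_le hp)

/-- The error of the quadrature rule with nodal polynomial `Ω ψ` for the function `1/x`. -/
theorem quadrature_error {w x : ι → ℝ} (hw : ∀ j, 0 ≤ w j) (hx : ∀ j, w j ≠ 0 → 0 < x j)
    {K m : ℕ} (hK : SeparatesMonic w x K) (hm : m ≤ K) {ψ Ω : ℝ[X]}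
    (hψ : IsMonicOfDegree ψ m)
    (horth : ∀ t : ℝ[X], t.degree < m → moment w x (Ω * ψ * t) = 0) {σ : ℝ}
    (hσ : ∀ j, w j ≠ 0 → 0 < σ / Ω.eval 0 * Ω.eval (x j)) (hΩ : Ω.eval 0 ≠ 0) :
    (Ω * ψ).eval 0 ≠ 0 ∧
    0 ≤ σ * (moment (fun j => w j / x j) x (Ω * ψ) / (Ω * ψ).eval 0) ∧
    ∀ p : ℝ[X], p.natDegree ≤ m → p.eval 0 = 1 →
      σ * (moment (fun j => w j / x j) x (Ω * ψ) / (Ω * ψ).eval 0) ≤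
        moment (fun j => w j / x j) x (C (σ / Ω.eval 0) * Ω * p ^ 2) := by
  set ν := moment (fun j => w j / x j) x with hν
  -- Here `τ = 0`: the support is positive, so `Ω · X` has the sign of `Ω` there.
  have hψ0 : ψ.eval 0 ≠ 0 := hK.eval_ne_zero hw hm hψ horth (σ := σ / Ω.eval 0) fun j hj => by
    have := mul_pos (hσ j hj) (hx j hj)
    simpa [mul_assoc] using this
  set c := ψ.eval 0
  set ω := C (σ / Ω.eval 0) * Ω with hω
  set φ := C c⁻¹ * ψ with hφ
  have hν0 : ∀ j, w j / x j ≠ 0 → w j ≠ 0 := fun j h h' => h (by simp [h'])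
  have hνw : ∀ j, 0 ≤ w j / x j := fun j => by
    by_cases h : w j = 0
    · simp [h]
    · exact div_nonneg (hw j) (hx j h).le
  have hωpos : ∀ j, w j ≠ 0 → 0 < ω.eval (x j) := fun j hj => by simpa [hω] using hσ j hj
  have horth' : ∀ t : ℝ[X], t.degree < m → moment w x (ω * φ * t) = 0 := fun t ht => by
    rw [show ω * φ * t = C (σ / Ω.eval 0) * (C c⁻¹ * (Ω * ψ * t)) by rw [hω, hφ]; ring,
      moment_C_mul, moment_C_mul, horth t ht, mul_zero, mul_zero]
  have hφ0 : φ.coeff 0 = 1 := by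
    rw [coeff_zero_eq_eval_zero, hφ, eval_mul, eval_C]; exact inv_mul_cancel₀ hψ0
  have hφd : φ.natDegree ≤ m := (natDegree_C_mul_le _ _).trans hψ.natDegree_eq.le
  have hE : σ * (ν (Ω * ψ) / (Ω * ψ).eval 0) = ν (ω * φ) := by
    rw [show ω * φ = C (σ / Ω.eval 0) * (C c⁻¹ * (Ω * ψ)) by rw [hω, hφ]; ring,
      hν, moment_C_mul, moment_C_mul, eval_mul]
    change _ * (_ / (_ * c)) = _
    field_simp
  -- As `φ(0) = 1`, `φ - 1` is `X` times a polynomial of degree below `m`; the factor `X` changes ν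
  -- into μ, and orthogonality removes the term.
  have hsq : ν (ω * φ ^ 2) = ν (ω * φ) := by
    have h1 : ω * φ ^ 2 = ω * φ + X * (ω * φ * φ.divX) := by
      have h := X_mul_divX_add φ
      rw [hφ0, C_1] at h
      linear_combination -(ω * φ) * h
    rw [h1, map_add, hν, moment_div_X_mul hx,
      horth' _ (degree_divX_lt_of_natDegree_le hφd), add_zero]
  have hpos : ∀ s : ℝ[X], 0 ≤ ν (ω * s ^ 2) := fun s => moment_nonneg hνw fun j hj => by
    have := hωpos j (hν0 j hj)
    simp only [eval_mul, eval_pow]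
    positivity
  refine ⟨by rw [eval_mul]; exact mul_ne_zero hΩ hψ0, ?_, fun p hp hp0 => ?_⟩
  · rw [hE, ← hsq]; exact hpos φ
  · rw [hE, ← hsq]
    set s := (p - φ).divX
    have hs : p = φ + X * s := by
      have h := X_mul_divX_add (p - φ)
      rw [coeff_sub, hφ0, coeff_zero_eq_eval_zero, hp0, sub_self, C_0] at h
      linear_combination -h
    have hsd : s.degree < m :=
      degree_divX_lt_of_natDegree_le ((natDegree_sub_le _ _).trans (max_le hp hφd))
    -- Pythagoras for the competitor `p = φ + X s`: the cross term is a μ-integral of `ω φ s` and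
    -- vanishes, so `φ` is the minimizer.
    rw [show ω * p ^ 2 = ω * φ ^ 2 + X * (C 2 * (ω * φ * s)) + ω * (X * s) ^ 2 by
      rw [hs, show (C 2 : ℝ[X]) = 2 from rfl]; ring]
    rw [map_add, map_add]
    have h1 : ν (X * (C 2 * (ω * φ * s))) = 0 := by
      rw [hν, moment_div_X_mul hx, moment_C_mul, horth' s hsd, mul_zero]
    have := hpos (X * s)
    linarith

end Moment

/-! ### Orthogonality from the three-term recurrence. -/

section Jacobi

/-- The characteristic polynomials of the leading blocks of the Jacobi matrix with diagonal
entries `α 1, α 2, …` and off-diagonal entries `β 1, β 2, …`. -/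
noncomputable def jacobiPoly (α β : ℕ → ℝ) : ℕ → ℝ[X]
  | 0 => 1
  | 1 => X - C (α 1)
  | n + 2 => (X - C (α (n + 2))) * jacobiPoly α β (n + 1) - C (β (n + 1) ^ 2) * jacobiPoly α β n

theorem isMonicOfDegree_extension {p q : ℝ[X]} {n : ℕ} (hp : IsMonicOfDegree p (n + 1))
    (hq : IsMonicOfDegree q n) (a b : ℝ) :
    IsMonicOfDegree ((X - C a) * p - C b * q) (n + 2) := by
  have h := (isMonicOfDegree_X_sub_one a).mul hp
  rw [show 1 + (n + 1) = n + 2 by ring] at h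
  exact h.sub ((natDegree_C_mul_le _ _).trans_lt (by rw [hq.natDegree_eq]; omega))

theorem isMonicOfDegree_jacobiPoly (α β : ℕ → ℝ) : ∀ n, IsMonicOfDegree (jacobiPoly α β n) n
  | 0 => by simp [jacobiPoly]
  | 1 => isMonicOfDegree_X_sub_one _
  | n + 2 => isMonicOfDegree_extension (isMonicOfDegree_jacobiPoly α β (n + 1))
      (isMonicOfDegree_jacobiPoly α β n) _ _

theorem X_mul_jacobiPoly {α β : ℕ → ℝ} (hβ : β 0 = 0) : ∀ n,
    X * jacobiPoly α β n = jacobiPoly α β (n + 1) + C (α (n + 1)) * jacobiPoly α β n +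
      C (β n ^ 2) * jacobiPoly α β (n - 1)
  | 0 => by simp [jacobiPoly, hβ]
  | n + 1 => by
    rw [Nat.add_sub_cancel, show n + 1 + 1 = n + 2 from rfl, jacobiPoly]
    ring

variable {ι : Type*} [Fintype ι]

/-- The coefficients `α`, `β` are those of the three-term recurrence of the monic orthogonal
polynomials of the discrete measure with nodes `x` and weights `w`. -/
structure IsRecurrence (w x : ι → ℝ) (α β : ℕ → ℝ) : Prop where
  beta_zero : β 0 = 0
  alpha_succ : ∀ n, moment w x (X * jacobiPoly α β n * jacobiPoly α β n) =
    α (n + 1) * moment w x (jacobiPoly α β n * jacobiPoly α β n)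
  beta_succ : ∀ n, moment w x (jacobiPoly α β (n + 1) * jacobiPoly α β (n + 1)) =
    β (n + 1) ^ 2 * moment w x (jacobiPoly α β n * jacobiPoly α β n)

namespace IsRecurrence

variable {w x : ι → ℝ} {α β : ℕ → ℝ}

/-- Induction on the larger index: the recurrence lowers it, multiplication by `X` moves to the
other factor, and the conditions on `α` and `β` cancel the surviving diagonal terms. The truncated
index `n - 1` at `n = 0` is harmless because `β 0 = 0`. -/
theorem moment_mul_eq_zero (h : IsRecurrence w x α β) {i j : ℕ} (hij : j < i) :
    moment w x (jacobiPoly α β i * jacobiPoly α β j) = 0 := by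
  suffices H : ∀ n, ∀ i ≤ n, ∀ j < i, moment w x (jacobiPoly α β i * jacobiPoly α β j) = 0 from
    H i i le_rfl j hij
  clear i j hij
  intro n
  induction n with
  | zero => intro i hi j hj; omega
  | succ n ih =>
    intro i hi j hj
    obtain hi | rfl := Nat.le_succ_iff.1 hi
    · exact ih i hi j hj
    have key : ∀ p : ℝ[X], moment w x (jacobiPoly α β (n + 1) * p) =
        moment w x (jacobiPoly α β n * (X * p)) - α (n + 1) * moment w x (jacobiPoly α β n * p) -
          β n ^ 2 * moment w x (jacobiPoly α β (n - 1) * p) := fun p => by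
      rw [← moment_C_mul, ← moment_C_mul, ← map_sub, ← map_sub]
      congr 1
      linear_combination -p * X_mul_jacobiPoly (α := α) h.beta_zero n
    have expand : ∀ j, moment w x (jacobiPoly α β n * (X * jacobiPoly α β j)) =
        moment w x (jacobiPoly α β n * jacobiPoly α β (j + 1)) +
        α (j + 1) * moment w x (jacobiPoly α β n * jacobiPoly α β j) +
          β j ^ 2 * moment w x (jacobiPoly α β n * jacobiPoly α β (j - 1)) := fun j => by
      rw [← moment_C_mul, ← moment_C_mul, ← map_add, ← map_add]
      congr 1
      linear_combination jacobiPoly α β n * X_mul_jacobiPoly (α := α) h.beta_zero j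
    rw [key]
    obtain hj | rfl := Nat.lt_succ_iff_lt_or_eq.1 hj
    · rw [expand, ih n le_rfl j hj, ih n le_rfl (j - 1) (by omega)]
      -- For `j + 1 = n` two squared norms survive, and `beta_succ` cancels them.
      obtain hj' | rfl := (Nat.succ_le_of_lt hj).lt_or_eq
      · rw [ih n le_rfl (j + 1) hj']
        rw [ih (n - 1) (by omega) j (by omega)]
        ring
      · rw [Nat.succ_eq_add_one, Nat.add_sub_cancel, h.beta_succ]
        ring
    · rw [show jacobiPoly α β j * (X * jacobiPoly α β j) =
        X * jacobiPoly α β j * jacobiPoly α β j by ring, h.alpha_succ]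
      obtain _ | j := j
      · simp [h.beta_zero]
      · rw [Nat.add_sub_cancel, mul_comm (jacobiPoly α β j), ih (j + 1) le_rfl j (by omega)]
        ring

theorem moment_mul_eq_zero_of_degree_lt (h : IsRecurrence w x α β) {i : ℕ} {t : ℝ[X]}
    (ht : t.degree < i) : moment w x (jacobiPoly α β i * t) = 0 := by
  have H : ∀ m j, m + j < i →
      moment w x (jacobiPoly α β i * (X ^ m * jacobiPoly α β j)) = 0 := by
    intro m
    induction m with
    | zero => intro j hj; simpa using h.moment_mul_eq_zero (by omega)
    | succ m ih =>
      intro j hj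
      rw [show jacobiPoly α β i * (X ^ (m + 1) * jacobiPoly α β j) =
        jacobiPoly α β i * (X ^ m * jacobiPoly α β (j + 1)) +
        C (α (j + 1)) * (jacobiPoly α β i * (X ^ m * jacobiPoly α β j)) +
        C (β j ^ 2) * (jacobiPoly α β i * (X ^ m * jacobiPoly α β (j - 1))) by
          linear_combination jacobiPoly α β i * X ^ m * X_mul_jacobiPoly (α := α) h.beta_zero j,
        map_add, map_add, moment_C_mul, moment_C_mul, ih _ (by omega), ih _ (by omega),
        ih _ (by omega)]
      ring
  by_cases h0 : t = 0
  · simp [h0]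
  rw [t.as_sum_range_C_mul_X_pow' ((natDegree_lt_iff_degree_lt h0).2 ht), Finset.mul_sum,
    map_sum]
  refine Finset.sum_eq_zero fun m hm => ?_
  have := H m 0 (by simpa using hm)
  rw [jacobiPoly, mul_one] at this
  rw [mul_left_comm, moment_C_mul, this, mul_zero]

theorem moment_mul_of_isMonicOfDegree (h : IsRecurrence w x α β) {i : ℕ} {t : ℝ[X]}
    (ht : IsMonicOfDegree t i) : moment w x (jacobiPoly α β i * t) =
      moment w x (jacobiPoly α β i * jacobiPoly α β i) := by
  have hπ := isMonicOfDegree_jacobiPoly α β i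
  have hd : (t - jacobiPoly α β i).degree < i := by
    obtain rfl | hi := eq_or_ne i 0
    · rw [isMonicOfDegree_zero_iff] at ht
      simp [ht, jacobiPoly]
    · by_cases h0 : t - jacobiPoly α β i = 0
      · simp [h0, bot_lt_iff_ne_bot]
      · exact (natDegree_lt_iff_degree_lt h0).1 (ht.natDegree_sub_lt hi hπ)
  have := h.moment_mul_eq_zero_of_degree_lt hd
  rw [mul_sub, map_sub] at this
  linarith

/-- A monic `t` of degree `m` has the same integral against the `m`-th orthogonal polynomial as that
polynomial itself, so `t` vanishing on the support would make its norm zero. -/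
theorem separatesMonic (h : IsRecurrence w x α β) {K : ℕ}
    (hK : ∀ n < K, moment w x (jacobiPoly α β n * jacobiPoly α β n) ≠ 0) :
    SeparatesMonic w x K := by
  intro m hm t ht
  by_contra! hcon
  refine hK m hm ?_
  rw [← h.moment_mul_of_isMonicOfDegree ht, moment_apply]
  refine Finset.sum_eq_zero fun j _ => ?_
  by_cases hj : w j = 0
  · simp [hj]
  · simp [hcon j hj]

/-- The extension of the Jacobi matrix by a row with off-diagonal entry `β n` keeps the
orthogonality. -/
theorem moment_extension_mul_eq_zero (h : IsRecurrence w x α β) {n : ℕ} (a : ℝ) {t : ℝ[X]}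
    (ht : t.degree < (n + 1 : ℕ)) :
    moment w x (((X - C a) * jacobiPoly α β (n + 1) -
      C (β (n + 1) ^ 2) * jacobiPoly α β n) * t) = 0 := by
  have h1 : ((X - C a) * jacobiPoly α β (n + 1) - C (β (n + 1) ^ 2) * jacobiPoly α β n) * t =
      jacobiPoly α β (n + 1 + 1) * t + C (α (n + 1 + 1) - a) * (jacobiPoly α β (n + 1) * t) := by
    rw [show n + 1 + 1 = n + 2 from rfl, jacobiPoly, C_sub]
    ring
  rw [h1, map_add, moment_C_mul, h.moment_mul_eq_zero_of_degree_lt ht,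
    h.moment_mul_eq_zero_of_degree_lt (ht.trans (by exact_mod_cast (n + 1).lt_succ_self))]
  ring

/-- The Lobatto case: with an arbitrary `b` the extension is no longer a combination of the next two
orthogonal polynomials, which costs one degree of orthogonality. -/
theorem moment_extension_mul_eq_zero_of_degree_lt (h : IsRecurrence w x α β) {n : ℕ} (a b : ℝ)
    {t : ℝ[X]} (ht : t.degree < n) :
    moment w x (((X - C a) * jacobiPoly α β (n + 1) - C b * jacobiPoly α β n) * t) = 0 := by
  have hX : ((X - C a) * t).degree < ((n + 1 : ℕ) : WithBot ℕ) := by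
    rw [degree_mul, degree_X_sub_C, Nat.cast_add, add_comm, Nat.cast_one]
    exact WithBot.add_lt_add_right (by simp) ht
  rw [show ((X - C a) * jacobiPoly α β (n + 1) - C b * jacobiPoly α β n) * t =
    jacobiPoly α β (n + 1) * ((X - C a) * t) - C b * (jacobiPoly α β n * t) by ring, map_sub,
    moment_C_mul, h.moment_mul_eq_zero_of_degree_lt hX, h.moment_mul_eq_zero_of_degree_lt ht]
  ring

end IsRecurrence

end Jacobi

/-! ### The iterates as ratios of moments and values at zero. -/

section Iterates

variable {N : ℕ} (A : Matrix (Fin N) (Fin N) ℝ) (u : EuclideanSpace ℝ (Fin N))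

/-- The monic Lanczos polynomials: `u_n` is a multiple of `p_n(A) u`. -/
noncomputable def lanczosPoly (n : ℕ) : ℝ[X] := jacobiPoly (lanczosAlpha A u) (lanczosBeta A u) n

/-- The nodal polynomial of the extension of `J_{n+1}` by the diagonal entry `a` and the squared
off-diagonal entry `b`. -/
noncomputable def extensionPoly (a b : ℝ) (n : ℕ) : ℝ[X] :=
  (X - C a) * lanczosPoly A u (n + 1) - C b * lanczosPoly A u n

theorem lanczosPoly_add_two (n : ℕ) : lanczosPoly A u (n + 2) =
    extensionPoly A u (lanczosAlpha A u (n + 2)) (lanczosBeta A u (n + 1) ^ 2) n := rfl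

theorem isMonicOfDegree_lanczosPoly (n : ℕ) : IsMonicOfDegree (lanczosPoly A u n) n :=
  isMonicOfDegree_jacobiPoly _ _ n

theorem isMonicOfDegree_extensionPoly (a b : ℝ) (n : ℕ) :
    IsMonicOfDegree (extensionPoly A u a b n) (n + 2) :=
  isMonicOfDegree_extension (isMonicOfDegree_lanczosPoly A u _)
    (isMonicOfDegree_lanczosPoly A u _) a b

theorem eval_extensionPoly (a b τ : ℝ) (n : ℕ) : (extensionPoly A u a b n).eval τ =
    (τ - a) * (lanczosPoly A u (n + 1)).eval τ - b * (lanczosPoly A u n).eval τ := by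
  simp [extensionPoly]

variable {A u}

/-- The pivots are the negative ratios of consecutive Lanczos polynomials. -/
theorem eval_lanczosPoly_succ {τ : ℝ} {n : ℕ} (h : ∀ i ≤ n, (lanczosPoly A u i).eval τ ≠ 0) :
    (lanczosPoly A u (n + 1)).eval τ = -delta A u τ (n + 1) * (lanczosPoly A u n).eval τ := by
  induction n with
  | zero => simp [lanczosPoly, jacobiPoly, delta]
  | succ n ih =>
    have h1 := ih fun i hi => h i (by omega)
    have h2 := h (n + 1) le_rfl
    have h3 : delta A u τ (n + 1) ≠ 0 := fun h0 => h2 (by rw [h1, h0]; simp)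
    rw [show n + 1 + 1 = n + 2 from rfl, lanczosPoly_add_two, eval_extensionPoly, delta]
    have h4 : (lanczosPoly A u n).eval τ =
        -(lanczosPoly A u (n + 1)).eval τ / delta A u τ (n + 1) := by
      rw [h1]; field_simp
    rw [h4]
    field_simp
    ring

theorem delta_ne_zero {τ : ℝ} {n : ℕ} (h : ∀ i ≤ n + 1, (lanczosPoly A u i).eval τ ≠ 0) :
    delta A u τ (n + 1) ≠ 0 := fun h0 => h (n + 1) le_rfl (by
  rw [eval_lanczosPoly_succ fun i hi => h i (by omega), h0]; simp)

variable {ι : Type*} [Fintype ι] {w x : ι → ℝ}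

/-- `c_{n+1}` is the product of the `β_l / δ_l` and `p_n(0)` that of the `-δ_l`, so the pivots
cancel and `‖u‖² ∏ β_l²` remains. -/
theorem norm_sq_mul_coeff_sq (hrec : IsRecurrence w x (lanczosAlpha A u) (lanczosBeta A u))
    (hone : moment w x 1 = ‖u‖ ^ 2) {n : ℕ} (h : ∀ i ≤ n, (lanczosPoly A u i).eval 0 ≠ 0) :
    ‖u‖ ^ 2 * coeff A u (n + 1) ^ 2 * (lanczosPoly A u n).eval 0 ^ 2 =
      moment w x (lanczosPoly A u n * lanczosPoly A u n) := by
  induction n with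
  | zero => simp [lanczosPoly, jacobiPoly, coeff, hone]
  | succ n ih =>
    have h1 := ih fun i hi => h i (by omega)
    have h2 := delta_ne_zero h
    rw [lanczosPoly, hrec.beta_succ]
    change _ = _ * moment w x (lanczosPoly A u n * lanczosPoly A u n)
    rw [← h1, coeff]
    change _ * _ * (lanczosPoly A u (n + 1)).eval 0 ^ 2 = _
    rw [eval_lanczosPoly_succ fun i hi => h i (by omega)]
    field_simp

theorem moment_extensionPoly (hx : ∀ j, w j ≠ 0 → 0 < x j)
    (hrec : IsRecurrence w x (lanczosAlpha A u) (lanczosBeta A u)) (a b : ℝ) (n : ℕ) :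
    moment (fun j => w j / x j) x (extensionPoly A u a b n) =
      -a * moment (fun j => w j / x j) x (lanczosPoly A u (n + 1)) -
        b * moment (fun j => w j / x j) x (lanczosPoly A u n) := by
  have h0 : moment w x (lanczosPoly A u (n + 1)) = 0 := by
    simpa [jacobiPoly, lanczosPoly] using hrec.moment_mul_eq_zero n.succ_pos
  rw [extensionPoly, sub_mul, map_sub, map_sub, moment_div_X_mul hx, moment_C_mul, moment_C_mul, h0]
  ring

/-- The Casoratian of the two solutions `ν(p_n)` and `p_n(0)` of the recurrence. -/
theorem casoratian (hx : ∀ j, w j ≠ 0 → 0 < x j)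
    (hrec : IsRecurrence w x (lanczosAlpha A u) (lanczosBeta A u)) (n : ℕ) :
    moment (fun j => w j / x j) x (lanczosPoly A u n) * (lanczosPoly A u (n + 1)).eval 0 -
      moment (fun j => w j / x j) x (lanczosPoly A u (n + 1)) * (lanczosPoly A u n).eval 0 =
      -moment w x (lanczosPoly A u n * lanczosPoly A u n) := by
  induction n with
  | zero =>
    have h1 := moment_div_X_mul hx 1
    rw [mul_one] at h1
    have h2 := moment_C_mul (fun j => w j / x j) x (lanczosAlpha A u 1) 1
    rw [mul_one] at h2
    simp [lanczosPoly, jacobiPoly, h1, h2]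
    ring
  | succ n ih =>
    have h1 : moment w x (lanczosPoly A u (n + 1) * lanczosPoly A u (n + 1)) =
      lanczosBeta A u (n + 1) ^ 2 * moment w x (lanczosPoly A u n * lanczosPoly A u n) :=
      hrec.beta_succ n
    rw [h1, show n + 1 + 1 = n + 2 from rfl, lanczosPoly_add_two, eval_extensionPoly,
      moment_extensionPoly hx hrec]
    linear_combination lanczosBeta A u (n + 1) ^ 2 * ih

/-- `ν(χ)` and `χ(0)` are the same combination, with coefficients `-a` and `-b`, of the data of
`p_{n+1}` and `p_n`. Over a common denominator the difference of ratios is therefore `b` times the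
Casoratian. -/
theorem increment_eq (hx : ∀ j, w j ≠ 0 → 0 < x j)
    (hrec : IsRecurrence w x (lanczosAlpha A u) (lanczosBeta A u))
    (hone : moment w x 1 = ‖u‖ ^ 2) {n : ℕ}
    (h : ∀ i ≤ n + 1, (lanczosPoly A u i).eval 0 ≠ 0) {a b : ℝ}
    (hext : (extensionPoly A u a b n).eval 0 ≠ 0) :
    increment A u (n + 1) a b =
      moment (fun j => w j / x j) x (lanczosPoly A u (n + 1)) / (lanczosPoly A u (n + 1)).eval 0 -
      moment (fun j => w j / x j) x (extensionPoly A u a b n) /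
        (extensionPoly A u a b n).eval 0 := by
  have hn : ∀ i ≤ n, (lanczosPoly A u i).eval 0 ≠ 0 := fun i hi => h i (by omega)
  have h1 := eval_lanczosPoly_succ hn
  have h2 := h (n + 1) le_rfl
  have h3 := hn n le_rfl
  have h4 := delta_ne_zero h
  have h5 := norm_sq_mul_coeff_sq hrec hone hn
  have h6 := casoratian hx hrec n
  have h7 : (extensionPoly A u a b n).eval 0 =
      (lanczosPoly A u n).eval 0 * (a * delta A u 0 (n + 1) - b) := by
    rw [eval_extensionPoly, h1]; ring
  have h8 : a * delta A u 0 (n + 1) - b ≠ 0 := fun h0 => hext (by rw [h7, h0, mul_zero])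
  rw [← h5, h1] at h6
  have h9 : delta A u 0 (n + 1) * moment (fun j => w j / x j) x (lanczosPoly A u n) +
      moment (fun j => w j / x j) x (lanczosPoly A u (n + 1)) =
      ‖u‖ ^ 2 * coeff A u (n + 1) ^ 2 * (lanczosPoly A u n).eval 0 :=
    mul_left_cancel₀ h3 (by linear_combination -h6)
  rw [mul_comm a] at h7 h8
  rw [moment_extensionPoly hx hrec, h7, increment, h1, mul_comm a]
  field_simp
  linear_combination -b * h9

theorem gauss_eq (hx : ∀ j, w j ≠ 0 → 0 < x j)
    (hrec : IsRecurrence w x (lanczosAlpha A u) (lanczosBeta A u))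
    (hone : moment w x 1 = ‖u‖ ^ 2) {n : ℕ}
    (h : ∀ i ≤ n + 1, (lanczosPoly A u i).eval 0 ≠ 0) :
    gauss A u (n + 1) = moment (fun j => w j / x j) x 1 -
      moment (fun j => w j / x j) x (lanczosPoly A u (n + 1)) /
        (lanczosPoly A u (n + 1)).eval 0 := by
  induction n with
  | zero =>
    have h1 := moment_div_X_mul hx 1
    rw [mul_one, hone] at h1
    have h2 := moment_C_mul (fun j => w j / x j) x (lanczosAlpha A u 1) 1
    rw [mul_one] at h2
    have h3 : lanczosAlpha A u 1 ≠ 0 := by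
      simpa [lanczosPoly, jacobiPoly] using h 1 le_rfl
    simp [lanczosPoly, jacobiPoly, h1, h2, gauss]
    field_simp
    ring
  | succ n ih =>
    rw [gauss, ih fun i hi => h i (by omega),
      increment_eq hx hrec hone (fun i hi => h i (by omega)) (h (n + 2) le_rfl),
      show n + 1 + 1 = n + 2 from rfl, lanczosPoly_add_two]
    ring

end Iterates

/-! ### The Lanczos process in the eigenbasis. -/

section Spectral

variable {N : ℕ} {A : Matrix (Fin N) (Fin N) ℝ} {lam : Fin N → ℝ}
  {q : OrthonormalBasis (Fin N) ℝ (EuclideanSpace ℝ (Fin N))}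

theorem isSymmetric_toEuclideanLin (hA : A.IsSymm) : A.toEuclideanLin.IsSymmetric :=
  Matrix.isSymmetric_toEuclideanLin_iff.2 (by
    rw [Matrix.IsHermitian, Matrix.conjTranspose_eq_transpose_of_trivial]; exact hA)

theorem inner_eigenvector_apply (hA : A.IsSymm) (hq : ∀ j, A.toEuclideanLin (q j) = lam j • q j)
    (j : Fin N) (v : EuclideanSpace ℝ (Fin N)) :
    inner ℝ (q j) (A.toEuclideanLin v) = lam j * inner ℝ (q j) v := by
  rw [← isSymmetric_toEuclideanLin hA, hq, real_inner_smul_left]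

variable (A) (u : EuclideanSpace ℝ (Fin N))

/-- The product `‖u‖ β_1 ⋯ β_n`. -/
noncomputable def lanczosScale (n : ℕ) : ℝ := ‖u‖ * ∏ l ∈ Finset.range n, lanczosBeta A u (l + 1)

theorem lanczosScale_succ (n : ℕ) :
    lanczosScale A u (n + 1) = lanczosScale A u n * lanczosBeta A u (n + 1) := by
  rw [lanczosScale, Finset.prod_range_succ, ← mul_assoc, lanczosScale]

theorem beta_smul_cur (n : ℕ) :
    lanczosBeta A u (n + 1) • (lanczos A u (n + 1)).cur = (lanczos A u n).residual A := by
  simp only [lanczosBeta, lanczos]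
  by_cases h : (lanczos A u n).residual A = 0
  · simp [h]
  · rw [smul_smul, mul_inv_cancel₀ (norm_ne_zero_iff.2 h), one_smul]

variable {u}

theorem norm_smul_cur_zero : ‖u‖ • (lanczos A u 0).cur = u := by
  by_cases h : u = 0
  · simp [h]
  · rw [lanczos, smul_smul, mul_inv_cancel₀ (norm_ne_zero_iff.2 h), one_smul]

/-- `u_n` is a unit vector unless the process has broken down, and then the scale is zero; the
factor makes the identity unconditional. -/
theorem scale_sq_mul_norm_sq_cur (n : ℕ) :
    lanczosScale A u n ^ 2 * ‖(lanczos A u n).cur‖ ^ 2 = lanczosScale A u n ^ 2 := by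
  obtain _ | n := n
  · have h := congrArg norm (norm_smul_cur_zero A (u := u))
    rw [norm_smul, norm_norm] at h
    simp only [lanczosScale, Finset.range_zero, Finset.prod_empty, mul_one]
    rw [← mul_pow, h]
  · have h := congrArg norm (beta_smul_cur A u n)
    rw [norm_smul, Real.norm_eq_abs] at h
    have hb : ‖(lanczos A u n).residual A‖ = lanczosBeta A u (n + 1) := rfl
    have h0 : 0 ≤ lanczosBeta A u (n + 1) := hb ▸ norm_nonneg _
    rw [hb, abs_of_nonneg h0] at h
    rw [lanczosScale_succ, ← mul_pow, mul_assoc, h]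

variable {A}

/-- The Lanczos vectors in the eigenbasis. -/
theorem scale_mul_inner_cur (hA : A.IsSymm) (hq : ∀ j, A.toEuclideanLin (q j) = lam j • q j)
    (j : Fin N) : ∀ n, lanczosScale A u n * inner ℝ (q j) (lanczos A u n).cur =
      (lanczosPoly A u n).eval (lam j) * inner ℝ (q j) u
  | 0 => by
    conv_rhs => rw [← norm_smul_cur_zero A (u := u), real_inner_smul_right]
    simp [lanczosScale, lanczosPoly, jacobiPoly]
  | 1 => by
    have h0 := scale_mul_inner_cur hA hq j 0
    rw [lanczosScale_succ, mul_assoc, ← real_inner_smul_right, beta_smul_cur,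
      LanczosState.residual, inner_sub_right, inner_sub_right, inner_eigenvector_apply hA hq,
      real_inner_smul_right, real_inner_smul_right]
    have h1 : inner ℝ (lanczos A u 0).cur (A.toEuclideanLin (lanczos A u 0).cur) =
      lanczosAlpha A u 1 := rfl
    have h2 : (lanczos A u 0).beta = 0 := rfl
    rw [h1, h2]
    simp [lanczosPoly, jacobiPoly] at h0 ⊢
    linear_combination (lam j - lanczosAlpha A u 1) * h0
  | n + 2 => by
    have h0 := scale_mul_inner_cur hA hq j n
    have h1 := scale_mul_inner_cur hA hq j (n + 1)
    have h2 : inner ℝ (lanczos A u (n + 1)).cur (A.toEuclideanLin (lanczos A u (n + 1)).cur) =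
      lanczosAlpha A u (n + 2) := rfl
    have h3 : (lanczos A u (n + 1)).beta = lanczosBeta A u (n + 1) := rfl
    have h4 : (lanczos A u (n + 1)).prev = (lanczos A u n).cur := rfl
    rw [lanczosScale_succ, mul_assoc, ← real_inner_smul_right, beta_smul_cur,
      LanczosState.residual, inner_sub_right, inner_sub_right, inner_eigenvector_apply hA hq,
      real_inner_smul_right, real_inner_smul_right, h2, h3, h4, lanczosPoly_add_two,
      eval_extensionPoly]
    have h5 := lanczosScale_succ A u n
    linear_combination (lam j - lanczosAlpha A u (n + 2)) * h1 -
      lanczosBeta A u (n + 1) ^ 2 * h0 -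
      lanczosBeta A u (n + 1) * inner ℝ (q j) (lanczos A u n).cur * h5

theorem moment_lanczosPoly_sq (hA : A.IsSymm)
    (hq : ∀ j, A.toEuclideanLin (q j) = lam j • q j) (n : ℕ) :
    moment (fun j => inner ℝ (q j) u ^ 2) lam (lanczosPoly A u n * lanczosPoly A u n) =
      lanczosScale A u n ^ 2 := by
  rw [← scale_sq_mul_norm_sq_cur A n, ← q.sum_sq_inner_right, Finset.mul_sum, moment_apply]
  refine Finset.sum_congr rfl fun j _ => ?_
  rw [eval_mul]
  linear_combination -(lanczosScale A u n * inner ℝ (q j) (lanczos A u n).cur +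
    (lanczosPoly A u n).eval (lam j) * inner ℝ (q j) u) * scale_mul_inner_cur hA hq j n

theorem isRecurrence_lanczos (hA : A.IsSymm)
    (hq : ∀ j, A.toEuclideanLin (q j) = lam j • q j) :
    IsRecurrence (fun j => inner ℝ (q j) u ^ 2) lam (lanczosAlpha A u) (lanczosBeta A u) where
  beta_zero := rfl
  alpha_succ n := by
    change moment _ _ (X * lanczosPoly A u n * lanczosPoly A u n) =
      _ * moment _ _ (lanczosPoly A u n * lanczosPoly A u n)
    have h1 : lanczosAlpha A u (n + 1) =
      inner ℝ (lanczos A u n).cur (A.toEuclideanLin (lanczos A u n).cur) := rfl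
    rw [moment_lanczosPoly_sq hA hq, h1, ← q.sum_inner_mul_inner, Finset.sum_mul, moment_apply]
    refine Finset.sum_congr rfl fun j _ => ?_
    rw [inner_eigenvector_apply hA hq, real_inner_comm (q j)]
    simp only [eval_mul, eval_X]
    linear_combination -lam j * (lanczosScale A u n * inner ℝ (q j) (lanczos A u n).cur +
      (lanczosPoly A u n).eval (lam j) * inner ℝ (q j) u) * scale_mul_inner_cur hA hq j n
  beta_succ n := by
    change moment _ _ (lanczosPoly A u (n + 1) * lanczosPoly A u (n + 1)) =
      _ * moment _ _ (lanczosPoly A u n * lanczosPoly A u n)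
    rw [moment_lanczosPoly_sq hA hq, moment_lanczosPoly_sq hA hq, lanczosScale_succ]
    ring

theorem moment_one_eq_norm_sq :
    moment (fun j => inner ℝ (q j) u ^ 2) lam 1 = ‖u‖ ^ 2 := by
  simp [moment_apply, q.sum_sq_inner_right]

/-- The value `uᵀ A† u` as an integral of `1/x`. -/
theorem moment_div_one_eq (hA : A.IsSymm)
    (hq : ∀ j, A.toEuclideanLin (q j) = lam j • q j)
    (hx : ∀ j, inner ℝ (q j) u ^ 2 ≠ 0 → 0 < lam j)
    {P : Matrix (Fin N) (Fin N) ℝ} (hP : IsPseudoInverse A P) :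
    moment (fun j => inner ℝ (q j) u ^ 2 / lam j) lam 1 = inner ℝ u (P.toEuclideanLin u) := by
  -- `v` solves `A v = u`; components with `λ_j = 0` are harmless since `u` has none there. Then `uᵀ
  -- P u = vᵀ A P A v = vᵀ A v = vᵀ u`.
  set v : EuclideanSpace ℝ (Fin N) := ∑ j, (inner ℝ (q j) u / lam j) • q j with hv
  have hqv : ∀ j, inner ℝ (q j) v = inner ℝ (q j) u / lam j := fun j => by
    rw [hv, inner_sum, Finset.sum_eq_single j]
    · rw [real_inner_smul_right, q.inner_eq_one, mul_one]
    · intro i _ hij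
      rw [real_inner_smul_right, q.inner_eq_zero hij.symm, mul_zero]
    · simp
  have hAv : A.toEuclideanLin v = u := by
    refine q.repr.injective (PiLp.ext fun j => ?_)
    rw [q.repr_apply_apply, q.repr_apply_apply, inner_eigenvector_apply hA hq, hqv]
    by_cases h : inner ℝ (q j) u = 0
    · simp [h]
    · exact mul_div_cancel₀ _ (hx j (pow_ne_zero 2 h)).ne'
  have hAPA : A.toEuclideanLin (P.toEuclideanLin (A.toEuclideanLin v)) = A.toEuclideanLin v := by
    conv_rhs => rw [← hP.mul_mul_self]
    simp [Matrix.toLpLin_apply, Matrix.mulVec_mulVec, Matrix.mul_assoc]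
  calc moment (fun j => inner ℝ (q j) u ^ 2 / lam j) lam 1
      = inner ℝ v u := by
        rw [← q.sum_inner_mul_inner, moment_apply]
        refine Finset.sum_congr rfl fun j _ => ?_
        rw [real_inner_comm (q j) v, hqv, eval_one]
        ring
    _ = inner ℝ u (P.toEuclideanLin u) := by
        rw [hAv] at hAPA
        conv_lhs => rw [← hAPA]
        rw [← isSymmetric_toEuclideanLin hA, hAv]

end Spectral

/-! ### Error bounds for the four rules. -/

section Errors

variable {N : ℕ} {ι : Type*} [Fintype ι]

/-- The discrete measure with nodes `x ⊆ [a, b]` and weights `w` generates the coefficients of the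
Lanczos iteration, and the first `K` Lanczos polynomials do not vanish on its support. -/
structure IsLanczosMeasure (A : Matrix (Fin N) (Fin N) ℝ) (u : EuclideanSpace ℝ (Fin N))
    (w x : ι → ℝ) (a b : ℝ) (K : ℕ) : Prop where
  pos : 0 < a
  le : a ≤ b
  weight_nonneg : ∀ j, 0 ≤ w j
  node_mem : ∀ j, w j ≠ 0 → x j ∈ Set.Icc a b
  isRecurrence : IsRecurrence w x (lanczosAlpha A u) (lanczosBeta A u)
  moment_one : moment w x 1 = ‖u‖ ^ 2
  moment_ne_zero : ∀ n < K, moment w x (lanczosPoly A u n * lanczosPoly A u n) ≠ 0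

/-- The Chebyshev bound `1 / T_m((κ + 1) / (κ - 1))`, with `κ = b / a`. -/
noncomputable def chebyshevBound (κ : ℝ) (m : ℕ) : ℝ := 2 * rate κ ^ m / (1 + (rate κ ^ m) ^ 2)

namespace IsLanczosMeasure

variable {A : Matrix (Fin N) (Fin N) ℝ} {u : EuclideanSpace ℝ (Fin N)} {w x : ι → ℝ} {a b : ℝ}
  {K : ℕ}

theorem node_pos (h : IsLanczosMeasure A u w x a b K) (j : ι) (hj : w j ≠ 0) : 0 < x j :=
  h.pos.trans_le (h.node_mem j hj).1

theorem separatesMonic (h : IsLanczosMeasure A u w x a b K) : SeparatesMonic w x K :=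
  h.isRecurrence.separatesMonic h.moment_ne_zero

theorem quadrature_error_le (h : IsLanczosMeasure A u w x a b K) {m : ℕ} (hm : m ≤ K)
    {ψ Ω : ℝ[X]} (hψ : IsMonicOfDegree ψ m)
    (horth : ∀ t : ℝ[X], t.degree < m → moment w x (Ω * ψ * t) = 0) {σ M : ℝ}
    (hΩ : Ω.eval 0 ≠ 0) (hσ : ∀ y ∈ Set.Icc a b, 0 < σ / Ω.eval 0 * Ω.eval y)
    (hM : ∀ y ∈ Set.Icc a b, σ / Ω.eval 0 * Ω.eval y ≤ M) :
    (Ω * ψ).eval 0 ≠ 0 ∧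
    0 ≤ σ * (moment (fun j => w j / x j) x (Ω * ψ) / (Ω * ψ).eval 0) ∧
    σ * (moment (fun j => w j / x j) x (Ω * ψ) / (Ω * ψ).eval 0) ≤
      M * chebyshevBound (b / a) m ^ 2 * moment (fun j => w j / x j) x 1 := by
  obtain ⟨h1, h2, h3⟩ := quadrature_error h.weight_nonneg h.node_pos h.separatesMonic hm hψ horth
    (fun j hj => hσ _ (h.node_mem j hj)) hΩ
  refine ⟨h1, h2, ?_⟩
  obtain ⟨p, hp, hp0, hpb⟩ := exists_poly_small_on_Icc h.pos h.le m
  refine (h3 p hp hp0).trans (moment_le_of_eval_le (fun j => ?_) fun j hj => ?_)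
  · by_cases hj : w j = 0
    · simp [hj]
    · exact div_nonneg (h.weight_nonneg j) (h.node_pos j hj).le
  · have hy := h.node_mem j fun h0 => hj (by simp [h0])
    rw [eval_mul, eval_mul, eval_C, eval_pow, ← sq_abs (p.eval _)]
    have h4 := hσ _ hy
    have h5 := hM _ hy
    have h6 : |p.eval (x j)| ^ 2 ≤ chebyshevBound (b / a) m ^ 2 :=
      pow_le_pow_left₀ (abs_nonneg _) (hpb _ hy) 2
    exact mul_le_mul h5 h6 (by positivity) (h4.le.trans h5)

theorem eval_lanczosPoly_ne_zero (h : IsLanczosMeasure A u w x a b K) {τ : ℝ}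
    (hτ : τ < a ∨ b < τ) {n : ℕ} (hn : n ≤ K) : (lanczosPoly A u n).eval τ ≠ 0 := by
  have horth : ∀ t : ℝ[X], t.degree < n → moment w x (1 * lanczosPoly A u n * t) = 0 :=
    fun t ht => by rw [one_mul]; exact h.isRecurrence.moment_mul_eq_zero_of_degree_lt ht
  obtain hτ | hτ := hτ
  · refine h.separatesMonic.eval_ne_zero h.weight_nonneg hn (isMonicOfDegree_lanczosPoly A u n)
      horth (σ := 1) fun j hj => ?_
    have := (h.node_mem j hj).1
    simp only [eval_one]
    linarith
  · refine h.separatesMonic.eval_ne_zero h.weight_nonneg hn (isMonicOfDegree_lanczosPoly A u n)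
      horth (σ := -1) fun j hj => ?_
    have := (h.node_mem j hj).2
    simp only [eval_one]
    linarith

theorem gauss_eq (h : IsLanczosMeasure A u w x a b K) {n : ℕ} (hn : n + 1 ≤ K) :
    gauss A u (n + 1) = moment (fun j => w j / x j) x 1 -
      moment (fun j => w j / x j) x (lanczosPoly A u (n + 1)) /
        (lanczosPoly A u (n + 1)).eval 0 :=
  GQL.gauss_eq h.node_pos h.isRecurrence h.moment_one fun _ hi =>
    h.eval_lanczosPoly_ne_zero (Or.inl h.pos) (hi.trans hn)

theorem gauss_add_increment (h : IsLanczosMeasure A u w x a b K) {n : ℕ} (hn : n + 1 ≤ K)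
    {c d : ℝ} (hext : (extensionPoly A u c d n).eval 0 ≠ 0) :
    gauss A u (n + 1) + increment A u (n + 1) c d = moment (fun j => w j / x j) x 1 -
      moment (fun j => w j / x j) x (extensionPoly A u c d n) /
        (extensionPoly A u c d n).eval 0 := by
  rw [h.gauss_eq hn, increment_eq h.node_pos h.isRecurrence h.moment_one (fun i hi =>
    h.eval_lanczosPoly_ne_zero (Or.inl h.pos) (hi.trans hn)) hext]
  ring

theorem gauss_error (h : IsLanczosMeasure A u w x a b K) {n : ℕ} (hn : n + 1 ≤ K) :
    0 ≤ moment (fun j => w j / x j) x 1 - gauss A u (n + 1) ∧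
    moment (fun j => w j / x j) x 1 - gauss A u (n + 1) ≤
      1 * chebyshevBound (b / a) (n + 1) ^ 2 * moment (fun j => w j / x j) x 1 := by
  obtain ⟨-, h2, h3⟩ := h.quadrature_error_le hn (isMonicOfDegree_lanczosPoly A u (n + 1))
    (Ω := 1) (σ := 1) (M := 1)
    (fun t ht => by rw [one_mul]; exact h.isRecurrence.moment_mul_eq_zero_of_degree_lt ht)
    (by simp) (by simp) (by simp)
  rw [one_mul, one_mul] at h2 h3
  rw [h.gauss_eq hn, sub_sub_cancel]
  exact ⟨h2, h3⟩

/-- The error of the Gauss–Radau rule with a node `τ` on either side of the spectrum. -/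
theorem radau_error (h : IsLanczosMeasure A u w x a b K) {n : ℕ} (hn : n + 1 ≤ K) {τ σ M : ℝ}
    (hτ0 : τ ≠ 0) (hτ : τ < a ∨ b < τ) (hσ : ∀ y ∈ Set.Icc a b, 0 < σ * (1 - y / τ))
    (hM : ∀ y ∈ Set.Icc a b, σ * (1 - y / τ) ≤ M) :
    0 ≤ σ * (moment (fun j => w j / x j) x 1 - radau A u τ (n + 1)) ∧
    σ * (moment (fun j => w j / x j) x 1 - radau A u τ (n + 1)) ≤
      M * chebyshevBound (b / a) (n + 1) ^ 2 * moment (fun j => w j / x j) x 1 := by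
  have hne : ∀ i ≤ n + 1, (lanczosPoly A u i).eval τ ≠ 0 := fun i hi =>
    h.eval_lanczosPoly_ne_zero hτ (hi.trans hn)
  have hδ := delta_ne_zero hne
  have heval := eval_lanczosPoly_succ fun i hi => hne i (hi.trans n.le_succ)
  -- Since `p_{n+1}(τ) = -δ p_n(τ)`, this diagonal entry makes `τ` a root of the extended
  -- polynomial.
  set c := τ + lanczosBeta A u (n + 1) ^ 2 / delta A u τ (n + 1) with hc
  set d := lanczosBeta A u (n + 1) ^ 2 with hd
  obtain ⟨ψ, hψ, hχ⟩ := exists_eq_X_sub_C_mul_of_eval_eq_zero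
    (isMonicOfDegree_extensionPoly A u c d n) (τ := τ) (by
      rw [eval_extensionPoly, heval, hc]
      field_simp
      ring)
  have hΩ : ∀ y, σ / (X - C τ : ℝ[X]).eval 0 * (X - C τ : ℝ[X]).eval y = σ * (1 - y / τ) := by
    intro y
    simp only [eval_sub, eval_X, eval_C, zero_sub]
    field_simp
    ring
  obtain ⟨h1, h2, h3⟩ := h.quadrature_error_le hn hψ (Ω := X - C τ) (σ := σ) (M := M)
    (fun t ht => by rw [← hχ]; exact h.isRecurrence.moment_extension_mul_eq_zero c ht)
    (by simpa using hτ0) (fun y hy => by rw [hΩ]; exact hσ y hy)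
    (fun y hy => by rw [hΩ]; exact hM y hy)
  rw [← hχ] at h1 h2 h3
  have hr : radau A u τ (n + 1) = gauss A u (n + 1) + increment A u (n + 1) c d := rfl
  rw [hr, h.gauss_add_increment hn h1, sub_sub_cancel]
  exact ⟨h2, h3⟩

/-- This makes the Lobatto denominators nonzero. A common pivot `d` would make `p_{n+1} + d p_n`
divisible by `(X - lmin)(X - lmax)`; its quotient `s` is orthogonal to it, yet the product has one
sign on the support. The first pivots, where no such `s` exists, differ by `lmax - lmin`. -/
theorem delta_ne_delta (h : IsLanczosMeasure A u w x a b K) {n : ℕ} (hn : n + 1 ≤ K)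
    {lmin lmax : ℝ} (hmin : lmin < a) (hmax : b < lmax) :
    delta A u lmin (n + 1) ≠ delta A u lmax (n + 1) := by
  intro heq
  have e1 := eval_lanczosPoly_succ fun i (hi : i ≤ n) =>
    h.eval_lanczosPoly_ne_zero (Or.inl hmin) (show i ≤ K by omega)
  have e2 := eval_lanczosPoly_succ fun i (hi : i ≤ n) =>
    h.eval_lanczosPoly_ne_zero (Or.inr hmax) (show i ≤ K by omega)
  have hlt : lmin < lmax := hmin.trans_le (h.le.trans hmax.le)
  rw [← heq] at e2
  set d := delta A u lmin (n + 1)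
  obtain _ | n := n
  · simp only [lanczosPoly, jacobiPoly, eval_sub, eval_X, eval_C, eval_one] at e1 e2
    linarith
  · have hp : IsMonicOfDegree (lanczosPoly A u (n + 2) + C d * lanczosPoly A u (n + 1)) (n + 2) :=
      (isMonicOfDegree_lanczosPoly A u (n + 2)).add_right
        ((natDegree_C_mul_le _ _).trans_lt (by
          rw [(isMonicOfDegree_lanczosPoly A u (n + 1)).natDegree_eq]; omega))
    obtain ⟨r, hr, hpr⟩ := exists_eq_X_sub_C_mul_of_eval_eq_zero hp (τ := lmin) (by
      rw [eval_add, eval_mul, eval_C, e1]; ring)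
    have hr0 : r.eval lmax = 0 := by
      have h0 := congrArg (eval lmax) hpr
      rw [eval_add, eval_mul, eval_C, e2, eval_mul, eval_sub, eval_X, eval_C] at h0
      refine (mul_eq_zero.1 (h0.symm.trans (by ring))).resolve_left (sub_pos.2 hlt).ne'
    obtain ⟨s, hs, rfl⟩ := exists_eq_X_sub_C_mul_of_eval_eq_zero hr hr0
    have h1 := h.separatesMonic.moment_pos h.weight_nonneg (show n < K by omega) hs
      (Φ := (X - C lmin) * (C lmax - X)) (fun j hj => by
        have := h.node_mem j hj
        simp only [eval_mul, eval_sub, eval_X, eval_C]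
        exact mul_pos (by linarith [this.1]) (by linarith [this.2]))
    rw [show (X - C lmin) * (C lmax - X) * s ^ 2 =
      C (-1) * (lanczosPoly A u (n + 2) * s) + C (-d) * (lanczosPoly A u (n + 1) * s) by
        rw [C_neg, C_neg, C_1]; linear_combination s * hpr, map_add, moment_C_mul, moment_C_mul] at h1
    have h2 : moment w x (lanczosPoly A u (n + 2) * s) = 0 :=
      h.isRecurrence.moment_mul_eq_zero_of_degree_lt (degree_lt_of_isMonicOfDegree hs (by omega))
    have h3 : moment w x (lanczosPoly A u (n + 1) * s) = 0 :=
      h.isRecurrence.moment_mul_eq_zero_of_degree_lt (degree_lt_of_isMonicOfDegree hs (by omega))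
    rw [h2, h3] at h1
    simp at h1

/-- The error of the Gauss–Lobatto rule. -/
theorem lobatto_error (h : IsLanczosMeasure A u w x a b K) {n : ℕ} (hn : n + 1 ≤ K)
    {lmin lmax : ℝ} (hmin0 : 0 < lmin) (hmin : lmin < a) (hmax : b < lmax) :
    0 ≤ lobatto A u lmin lmax (n + 1) - moment (fun j => w j / x j) x 1 ∧
    lobatto A u lmin lmax (n + 1) - moment (fun j => w j / x j) x 1 ≤
      b / lmin * chebyshevBound (b / a) n ^ 2 * moment (fun j => w j / x j) x 1 := by
  have hne1 : ∀ i ≤ n + 1, (lanczosPoly A u i).eval lmin ≠ 0 := fun i hi =>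
    h.eval_lanczosPoly_ne_zero (Or.inl hmin) (hi.trans hn)
  have hne2 : ∀ i ≤ n + 1, (lanczosPoly A u i).eval lmax ≠ 0 := fun i hi =>
    h.eval_lanczosPoly_ne_zero (Or.inr hmax) (hi.trans hn)
  have hδ1 := delta_ne_zero hne1
  have hδ2 := delta_ne_zero hne2
  have heval1 := eval_lanczosPoly_succ fun i hi => hne1 i (hi.trans n.le_succ)
  have heval2 := eval_lanczosPoly_succ fun i hi => hne2 i (hi.trans n.le_succ)
  have hδ : delta A u lmax (n + 1) - delta A u lmin (n + 1) ≠ 0 :=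
    sub_ne_zero.2 (h.delta_ne_delta hn hmin hmax).symm
  have hlt : lmin < lmax := hmin.trans_le (h.le.trans hmax.le)
  have hmax0 : 0 < lmax := hmin0.trans hlt
  set c := lobattoAlpha A u lmin lmax (n + 1) with hc
  set d := lobattoBetaSq A u lmin lmax (n + 1) with hd
  -- The entries `c`, `d` solve `d = (c - τ) δ^τ` for both `τ = lmin` and `τ = lmax`, which puts a
  -- root at each.
  obtain ⟨r, hr, hχ⟩ := exists_eq_X_sub_C_mul_of_eval_eq_zero
    (isMonicOfDegree_extensionPoly A u c d n) (τ := lmin) (by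
      rw [eval_extensionPoly, heval1, hc, hd, lobattoAlpha, lobattoBetaSq]
      field_simp
      ring)
  have hr0 : r.eval lmax = 0 := by
    have h0 := congrArg (eval lmax) hχ
    rw [eval_extensionPoly, heval2, eval_mul, eval_sub, eval_X, eval_C] at h0
    refine (mul_eq_zero.1 (h0.symm.trans ?_)).resolve_left (sub_pos.2 hlt).ne'
    rw [hc, hd, lobattoAlpha, lobattoBetaSq]
    field_simp
    ring
  obtain ⟨ψ, hψ, rfl⟩ := exists_eq_X_sub_C_mul_of_eval_eq_zero hr hr0
  rw [← mul_assoc] at hχ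
  set Ω : ℝ[X] := (X - C lmin) * (X - C lmax) with hΩdef
  have hΩ0 : Ω.eval 0 = lmin * lmax := by simp [hΩdef]
  have hΩ : ∀ y, -1 / Ω.eval 0 * Ω.eval y = (y / lmin - 1) * (1 - y / lmax) := by
    intro y
    rw [hΩ0]
    simp only [hΩdef, eval_mul, eval_sub, eval_X, eval_C]
    field_simp
    ring
  have hpos : ∀ y ∈ Set.Icc a b, 0 < y / lmin - 1 ∧ 0 < 1 - y / lmax := fun y hy =>
    ⟨sub_pos.2 ((one_lt_div hmin0).2 (hmin.trans_le hy.1)),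
      sub_pos.2 ((div_lt_one hmax0).2 (hy.2.trans_lt hmax))⟩
  obtain ⟨h1, h2, h3⟩ := h.quadrature_error_le (show n ≤ K by omega) hψ (Ω := Ω) (σ := -1)
    (M := b / lmin)
    (fun t ht => by
      rw [← hχ]; exact h.isRecurrence.moment_extension_mul_eq_zero_of_degree_lt c d ht)
    (by rw [hΩ0]; positivity)
    (fun y hy => by rw [hΩ]; exact mul_pos (hpos y hy).1 (hpos y hy).2)
    (fun y hy => by
      rw [hΩ]
      have h4 : y / lmin ≤ b / lmin := div_le_div_of_nonneg_right hy.2 hmin0.le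
      have h5 : 0 < y / lmax := div_pos (h.pos.trans_le hy.1) hmax0
      refine (mul_le_of_le_one_right (hpos y hy).1.le (by linarith)).trans (by linarith))
  rw [← hχ] at h1 h2 h3
  have hr' : lobatto A u lmin lmax (n + 1) = gauss A u (n + 1) + increment A u (n + 1) c d := rfl
  rw [hr', h.gauss_add_increment hn h1, sub_sub_cancel_left, ← neg_one_mul]
  exact ⟨h2, h3⟩

end IsLanczosMeasure

end Errors

/-! ### Termination and exactness. -/

section Termination

variable {N : ℕ} {A : Matrix (Fin N) (Fin N) ℝ} {lam : Fin N → ℝ}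
  {q : OrthonormalBasis (Fin N) ℝ (EuclideanSpace ℝ (Fin N))} {u : EuclideanSpace ℝ (Fin N)}

theorem inner_eq_zero_of_mem_span {s : Set (Fin N)} (hu : u ∈ Submodule.span ℝ (q '' s))
    {j : Fin N} (hj : j ∉ s) : inner ℝ (q j) u = 0 := by
  have hle : Submodule.span ℝ (q '' s) ≤ LinearMap.ker (innerₛₗ ℝ (q j)) := by
    rw [Submodule.span_le]
    rintro _ ⟨i, hi, rfl⟩
    exact q.inner_eq_zero fun h => hj (h ▸ hi)
  exact hle hu

theorem lanczosScale_ne_zero (hu : u ≠ 0) {n : ℕ}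
    (hβ : ∀ l, 1 ≤ l → l ≤ n → lanczosBeta A u l ≠ 0) : lanczosScale A u n ≠ 0 :=
  mul_ne_zero (norm_ne_zero_iff.2 hu) (Finset.prod_ne_zero_iff.2 fun l hl =>
    hβ _ l.succ_pos (Finset.mem_range.1 hl))

/-- The iteration stops after at most as many steps as the spectral measure has nodes. -/
theorem exists_stopsAt (hA : A.IsSymm) (hq : ∀ j, A.toEuclideanLin (q j) = lam j • q j)
    (hu : u ≠ 0) (s : Finset (Fin N)) (hsu : ∀ j ∉ s, inner ℝ (q j) u = 0) :
    ∃ K, StopsAt A u K ∧ K ≤ s.card := by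
  classical
  have hex : ∃ l, 1 ≤ l ∧ l ≤ s.card ∧ lanczosBeta A u l = 0 := by
    by_contra! hcon
    have hsep := (isRecurrence_lanczos (u := u) hA hq).separatesMonic (K := s.card + 1)
      fun n hn => by
        have h := moment_lanczosPoly_sq (u := u) hA hq n
        exact h.trans_ne (pow_ne_zero 2 (lanczosScale_ne_zero hu fun l h1 h2 =>
          hcon l h1 (by omega)))
    -- This polynomial kills the whole support, which contradicts separation in degree `s.card`.
    have ht : IsMonicOfDegree (∏ j ∈ s, (X - C (lam j))) s.card :=
      ⟨natDegree_finsetProd_X_sub_C_eq_card _ _, monic_prod_X_sub_C _ _⟩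
    obtain ⟨j, hj, htj⟩ := hsep s.card s.card.lt_succ_self _ ht
    have hjs : j ∈ s := by
      by_contra h
      exact hj (by simp [hsu j h])
    exact htj (by rw [eval_prod]; exact Finset.prod_eq_zero hjs (by simp))
  obtain ⟨h1, h2, h3⟩ := Nat.find_spec hex
  refine ⟨Nat.find hex, ⟨h1, h3, fun j hj hjK h0 => ?_⟩, h2⟩
  exact Nat.find_min hex hjK ⟨hj, by omega, h0⟩

theorem StopsAt.eval_lanczosPoly_eq_zero {K : ℕ} (hK : StopsAt A u K) (hA : A.IsSymm)
    (hq : ∀ j, A.toEuclideanLin (q j) = lam j • q j) {j : Fin N} (hj : inner ℝ (q j) u ≠ 0) :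
    (lanczosPoly A u K).eval (lam j) = 0 := by
  obtain ⟨n, rfl⟩ := Nat.exists_eq_add_of_le' hK.1
  have h := scale_mul_inner_cur (u := u) hA hq j (n + 1)
  rw [lanczosScale_succ, hK.2.1, mul_zero, zero_mul] at h
  exact (mul_eq_zero.1 h.symm).resolve_right hj

theorem StopsAt.card_le {K : ℕ} (hK : StopsAt A u K) (hA : A.IsSymm)
    (hq : ∀ j, A.toEuclideanLin (q j) = lam j • q j) (hlam : Function.Injective lam)
    (s : Finset (Fin N)) (hs : ∀ j ∈ s, inner ℝ (q j) u ≠ 0) : s.card ≤ K := by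
  classical
  by_contra! hlt
  refine (isMonicOfDegree_lanczosPoly A u K).ne_zero
    (eq_zero_of_natDegree_lt_card_of_eval_eq_zero' _ (s.image lam) ?_ ?_)
  · intro y hy
    obtain ⟨j, hj, rfl⟩ := Finset.mem_image.1 hy
    exact hK.eval_lanczosPoly_eq_zero hA hq (hs j hj)
  · rw [(isMonicOfDegree_lanczosPoly A u K).natDegree_eq, Finset.card_image_of_injective _ hlam]
    exact hlt

theorem StopsAt.radau_eq_gauss {K : ℕ} (hK : StopsAt A u K) (τ : ℝ) :
    radau A u τ K = gauss A u K := by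
  simp [radau, increment, hK.2.1]

theorem StopsAt.isLanczosMeasure {K : ℕ} (hK : StopsAt A u K) (hA : A.IsSymm)
    (hq : ∀ j, A.toEuclideanLin (q j) = lam j • q j) (hu : u ≠ 0) {a b : ℝ} (ha : 0 < a)
    (hab : a ≤ b) (hmem : ∀ j, inner ℝ (q j) u ≠ 0 → lam j ∈ Set.Icc a b) :
    IsLanczosMeasure A u (fun j => inner ℝ (q j) u ^ 2) lam a b K where
  pos := ha
  le := hab
  weight_nonneg _ := sq_nonneg _
  node_mem j hj := hmem j fun h => hj (by simp [h])
  isRecurrence := isRecurrence_lanczos hA hq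
  moment_one := moment_one_eq_norm_sq
  moment_ne_zero n hn := by
    rw [moment_lanczosPoly_sq hA hq]
    exact pow_ne_zero 2 (lanczosScale_ne_zero hu fun l h1 h2 => hK.2.2 l h1 (by omega))

theorem StopsAt.gauss_eq_moment {K : ℕ} (hK : StopsAt A u K) (hA : A.IsSymm)
    (hq : ∀ j, A.toEuclideanLin (q j) = lam j • q j) {a b : ℝ}
    (h : IsLanczosMeasure A u (fun j => inner ℝ (q j) u ^ 2) lam a b K) :
    gauss A u K = moment (fun j => inner ℝ (q j) u ^ 2 / lam j) lam 1 := by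
  obtain ⟨n, hn⟩ := Nat.exists_eq_add_of_le' hK.1
  have h0 : moment (fun j => inner ℝ (q j) u ^ 2 / lam j) lam (lanczosPoly A u K) = 0 := by
    rw [moment_apply]
    refine Finset.sum_eq_zero fun j _ => ?_
    by_cases hj : inner ℝ (q j) u = 0
    · simp [hj]
    · simp [hK.eval_lanczosPoly_eq_zero hA hq hj]
  subst hn
  rw [h.gauss_eq le_rfl, h0, zero_div, sub_zero]

theorem IsLanczosMeasure.moment_div_pos {a b : ℝ} {K : ℕ}
    {ι : Type*} [Fintype ι] {w x : ι → ℝ} (h : IsLanczosMeasure A u w x a b K) (hK : 1 ≤ K) :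
    0 < moment (fun j => w j / x j) x 1 := by
  obtain ⟨j, hj, -⟩ := h.separatesMonic 0 hK 1 (isMonicOfDegree_zero_iff.2 rfl)
  refine Finset.sum_pos' (fun i _ => ?_) ⟨j, Finset.mem_univ _, ?_⟩
  · rw [eval_one, mul_one]
    by_cases hi : w i = 0
    · simp [hi]
    · exact div_nonneg (h.weight_nonneg i) (h.node_pos i hi).le
  · rw [eval_one, mul_one]
    exact div_pos ((h.weight_nonneg j).lt_of_ne' hj) (h.node_pos j hj)

end Termination

end GQL

/-- `lam 0 < ⋯ < lam (N-1)` are the eigenvalues and `q` the eigenvectors of the symmetric matrix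
`A`; the top `k` ones have the indices `N-k, …, N-1`. -/
theorem mainTheorem7 {N : ℕ} (A : Matrix (Fin N) (Fin N) ℝ) (hA : A.IsSymm)
    (lam : Fin N → ℝ) (hlam : StrictMono lam)
    (q : OrthonormalBasis (Fin N) ℝ (EuclideanSpace ℝ (Fin N)))
    (hq : ∀ j, A.toEuclideanLin (q j) = lam j • q j)
    (k : ℕ) (hk : 1 ≤ k) (hkN : k ≤ N)
    (hpos : 0 < lam ⟨N - k, by omega⟩)
    (u : EuclideanSpace ℝ (Fin N)) (hu : u ≠ 0)
    (huspan : u ∈ Submodule.span ℝ (q '' {j | N - k ≤ (j : ℕ)}))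
    (Adag : Matrix (Fin N) (Fin N) ℝ) (hAdag : GQL.IsPseudoInverse A Adag)
    (lmin lmax : ℝ) (hlmin : 0 < lmin) (hlmin' : lmin < lam ⟨N - k, by omega⟩)
    (hlmax : lam ⟨N - 1, by omega⟩ < lmax)
    (κ κm : ℝ) (hκ : κ = lam ⟨N - 1, by omega⟩ / lam ⟨N - k, by omega⟩)
    (hκm : κm = lam ⟨N - 1, by omega⟩ / lmin) :
    ∃ K : ℕ, GQL.StopsAt A u K ∧ K ≤ k ∧
      ((∀ j : Fin N, N - k ≤ (j : ℕ) → inner ℝ (q j) u ≠ 0) → K = k) ∧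
      -- the final iterates are exact
      GQL.gauss A u K = inner ℝ u (Adag.toEuclideanLin u) ∧
      GQL.rightRadau A u lmax K = inner ℝ u (Adag.toEuclideanLin u) ∧
      GQL.leftRadau A u lmin K = inner ℝ u (Adag.toEuclideanLin u) ∧
      -- relative errors
      ∀ i : ℕ, 1 ≤ i → i ≤ K →
        (0 ≤ (GQL.gauss A u K - GQL.gauss A u i) / GQL.gauss A u K ∧
          (GQL.gauss A u K - GQL.gauss A u i) / GQL.gauss A u K ≤ 2 * GQL.rate κ ^ i) ∧
        (0 ≤ (GQL.gauss A u K - GQL.rightRadau A u lmax i) / GQL.gauss A u K ∧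
          (GQL.gauss A u K - GQL.rightRadau A u lmax i) / GQL.gauss A u K
            ≤ 2 * GQL.rate κ ^ i) ∧
        (0 ≤ (GQL.leftRadau A u lmin i - GQL.gauss A u K) / GQL.gauss A u K ∧
          (GQL.leftRadau A u lmin i - GQL.gauss A u K) / GQL.gauss A u K
            ≤ 2 * κm * GQL.rate κ ^ i) ∧
        (0 ≤ (GQL.lobatto A u lmin lmax i - GQL.gauss A u K) / GQL.gauss A u K ∧
          (GQL.lobatto A u lmin lmax i - GQL.gauss A u K) / GQL.gauss A u K
            ≤ 2 * κm * GQL.rate κ ^ (i - 1) ∧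
          (3 ≤ i →
            (GQL.lobatto A u lmin lmax i - GQL.gauss A u K) / GQL.gauss A u K
              ≤ 2 * κm * GQL.rate κ ^ i)) := by
  have hle : lam ⟨N - k, by omega⟩ ≤ lam ⟨N - 1, by omega⟩ :=
    hlam.monotone (Fin.mk_le_mk.2 (by omega))
  set a := lam ⟨N - k, by omega⟩
  set b := lam ⟨N - 1, by omega⟩
  set s : Finset (Fin N) := Finset.univ.filter fun j => N - k ≤ (j : ℕ) with hs
  have hcard : s.card = k := by
    have h1 : s = Finset.Ici ⟨N - k, by omega⟩ := by
      ext j; simp [hs, Fin.le_def]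
    rw [h1, Fin.card_Ici]
    simp only
    omega
  have hsu : ∀ j ∉ s, inner ℝ (q j) u = 0 := fun j hj =>
    GQL.inner_eq_zero_of_mem_span huspan (by simpa [hs] using hj)
  obtain ⟨K, hK, hKk⟩ := GQL.exists_stopsAt hA hq hu s hsu
  have hmem : ∀ j, inner ℝ (q j) u ≠ 0 → lam j ∈ Set.Icc a b := fun j hj => by
    have hjs : j ∈ s := by
      by_contra h
      exact hj (hsu j h)
    have hjs' : N - k ≤ (j : ℕ) := by simpa [hs] using hjs
    exact ⟨hlam.monotone (Fin.mk_le_mk.2 hjs'), hlam.monotone (Fin.mk_le_mk.2 (by omega))⟩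
  have hm := hK.isLanczosMeasure hA hq hu hpos hle hmem
  have hgK := hK.gauss_eq_moment hA hq hm
  have hex : GQL.gauss A u K = inner ℝ u (Adag.toEuclideanLin u) :=
    hgK.trans (GQL.moment_div_one_eq hA hq hm.node_pos hAdag)
  refine ⟨K, hK, hKk.trans_eq hcard, fun hall => ?_, hex, (hK.radau_eq_gauss lmax).trans hex,
    (hK.radau_eq_gauss lmin).trans hex, ?_⟩
  · refine le_antisymm (hKk.trans_eq hcard) (hcard.symm.le.trans ?_)
    exact hK.card_le hA hq hlam.injective s fun j hj => hall j (by simpa [hs] using hj)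
  intro i hi hiK
  obtain ⟨n, rfl⟩ := Nat.exists_eq_add_of_le' hi
  have hg : 0 < GQL.gauss A u K := hgK ▸ hm.moment_div_pos hK.1
  have hb : 0 < b := hpos.trans_le hle
  have hlmax0 : 0 < lmax := hb.trans hlmax
  have hκm0 : 0 ≤ κm := by rw [hκm]; positivity
  have hrate : 0 ≤ GQL.rate κ := GQL.rate_nonneg (by rw [hκ]; exact (one_le_div hpos).2 hle)
  have hcheb : ∀ m, GQL.chebyshevBound (b / a) m ^ 2 ≤ 2 * GQL.rate κ ^ m := fun m => by
    rw [← hκ]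
    exact GQL.sq_two_mul_div_one_add_sq_le (pow_nonneg hrate m)
  have hrel : ∀ {e M B C : ℝ}, 0 ≤ M → B ≤ C → e ≤ M * B * GQL.gauss A u K →
      e / GQL.gauss A u K ≤ M * C := fun hM hB he =>
    (div_le_iff₀ hg).2 (he.trans (by gcongr))
  have hG := hm.gauss_error hiK
  have hR := hm.radau_error hiK (τ := lmax) (σ := 1) (M := 1) hlmax0.ne' (Or.inr hlmax)
    (fun y hy => by
      have := (div_lt_one hlmax0).2 (hy.2.trans_lt hlmax)
      linarith)
    (fun y hy => by
      have := div_pos (hpos.trans_le hy.1) hlmax0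
      linarith)
  have hL := hm.radau_error hiK (τ := lmin) (σ := -1) (M := κm) hlmin.ne' (Or.inl hlmin')
    (fun y hy => by
      have := (one_lt_div hlmin).2 (hlmin'.trans_le hy.1)
      linarith)
    (fun y hy => by
      have := div_le_div_of_nonneg_right hy.2 hlmin.le
      rw [hκm]
      linarith)
  have hLo := hm.lobatto_error hiK hlmin hlmin' hlmax
  rw [← hgK] at hG hR hL hLo
  rw [← hκm] at hLo
  rw [one_mul] at hR
  rw [neg_one_mul, neg_sub] at hL
  have hassoc : ∀ m, 2 * κm * GQL.rate κ ^ m = κm * (2 * GQL.rate κ ^ m) := fun m => by ring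
  rw [Nat.add_sub_cancel, hassoc, hassoc]
  refine ⟨⟨div_nonneg hG.1 hg.le, ?_⟩, ⟨div_nonneg hR.1 hg.le, ?_⟩, ⟨div_nonneg hL.1 hg.le, ?_⟩,
    div_nonneg hLo.1 hg.le, ?_, fun h3 => ?_⟩
  · exact (hrel zero_le_one (hcheb _) hG.2).trans_eq (one_mul _)
  · exact (hrel zero_le_one (hcheb _) hR.2).trans_eq (one_mul _)
  · exact hrel hκm0 (hcheb _) hL.2
  · exact hrel hκm0 (hcheb _) hLo.2
  -- With `i = n + 1` the Lobatto bound has Chebyshev degree `n ≥ 2`, exactly the range where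
  -- squaring gains a factor of the rate.
  · refine hrel hκm0 ?_ hLo.2
    rw [← hκ]
    exact GQL.sq_two_mul_pow_div_le hrate (GQL.rate_le_one κ) (by omega)
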